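/- Let $n,N\ge 1$ be integers and $0<p\le 1$. Use $\mathcal F f(\xi)=(2\pi)^{-n/2}\int_{\mathbb R^n} f(x)e^{-ix\cdot\xi}\,dx$, with inverse $\mathcal F^{-1}$, extended to the tempered distributions $\mathcal S'(\mathbb R^n)$ by duality; $B(0,R)$ is the open Euclidean ball, and $Q(z,r)=z+r[-\tfrac12,\tfrac12)^n$ for $z\in\mathbb R^n$, $r>0$. A matrix weight is a locally integrable function $W:\mathbb R^n\to\mathbb C^{N\times N}$ that is positive definite almost everywhere. It belongs to $\mathbf A_p$ if, with $\|\cdot\|$ the operator norm, $$[W]_{\mathbf A_p}:=\sup_{Q}\ \operatorname*{ess\,sup}_{y\in Q}\ \frac1{|Q|}\int_Q\big\|W(t)^{1/p}W(y)^{-1/p}\big\|^p\,dt<\infty ,$$ the supremum being over all cubes $Q=Q(z,r)$. Its doubling exponent $\beta$ is defined by letting $2^\beta$ be the least constant $C$ with $\int_{Q(z,2r)}|W^{1/p}(t)v|^p\,dt\le C\int_{Q(z,r)}|W^{1/p}(t)v|^p\,dt$ for all $v\in\mathbb C^N$ and all cubes $Q(z,r)$. $L^p(W)$ is the space of measurable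 $\mathbf f:\mathbb R^n\to\mathbb C^N$ with $\|\mathbf f\|_{L^p(W)}:=\big(\int_{\mathbb R^n}|W^{1/p}(x)\mathbf f(x)|^p\,dx\big)^{1/p}<\infty$. $E_R$ is the set of functions $\mathbf f=(f_1,\dots,f_N)$ such that each $f_i$ is a tempered distribution with $\operatorname{supp}\mathcal F f_i\subseteq B(0,R)$. For an integrable, compactly supported $\varphi:\mathbb R^n\to\mathbb C$ and $U\in\mathcal S'(\mathbb R^n)$, the product $\varphi\cdot U$ is the limit in $\mathcal S'(\mathbb R^n)$, as $\varepsilon\to0^+$, of $(\rho_\varepsilon*\varphi)\cdot U$ with $\rho_\varepsilon=\varepsilon^{-n}\rho(\cdot/\varepsilon)$, provided this limit exists and is the same for every $\rho\in C_c^\infty(\mathbb R^n)$ with $\rho\ge0$ and $\int\rho=1$ (for smooth $\varphi$ this is the usual product). Put $\varphi(D)f:=\mathcal F^{-1}[\varphi\cdot\mathcal F f]$, acting coordinatewise on vector functions. **Proposition.** For every $A\in[0,\infty)$ and $K\in\mathbb R$ there is a finite constant $C$, depending only on $A$, $K$, $p$ (and on the dimensions $n,N$), such that the following holds. Let $W\in\mathbf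 A_p$ be a matrix weight with $[W]_{\mathbf A_p}=A$ and doubling exponent $\beta$. Let $R>0$, $M>(n+\beta)/p$, and let $\varphi$ be an integrable function that vanishes outside $B(0,R)$ and satisfies $$|\mathcal F^{-1}\varphi(x)|\le K R^n(1+R|x|)^{-M}\qquad\text{for all }x\in\mathbb R^n .$$ Then for every $\mathbf f\in E_R\cap L^p(W)$ the multiplier $\varphi(D)\mathbf f$ is well defined, its coordinates are locally integrable functions, and $$\|\varphi(D)\mathbf f\|_{L^p(W)}\le C\,\|\mathbf f\|_{L^p(W)} .$$ In particular $C$ does not depend on $R$, $M$, $\beta$, $\varphi$, $\mathbf f$, nor on $W$ except through $[W]_{\mathbf A_p}$. -/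

import Mathlib

open MeasureTheory Filter Topology FourierTransform
open scoped ENNReal NNReal SchwartzMap ContDiff ComplexOrder

namespace MatrixWeight

noncomputable section

/-- Euclidean space `ℝⁿ`. -/
abbrev Rn (n : ℕ) : Type := EuclideanSpace ℝ (Fin n)

/-- The Hilbert space `ℂᴺ`. -/
abbrev CN (N : ℕ) : Type := EuclideanSpace ℂ (Fin N)

/-! ### Matrix weights, the class `A_p`, the doubling exponent, and `L^p(W)` -/

/-- The real power `A ^ s` of a Hermitian matrix with positive eigenvalues, by the spectral theorem:
the eigenvectors are kept and each eigenvalue `x` is replaced by `x ^ s`. -/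
def matPow {N : ℕ} (A : Matrix (Fin N) (Fin N) ℂ) (s : ℝ) : Matrix (Fin N) (Fin N) ℂ :=
  cfc (fun x : ℝ => x ^ s) A

/-- The operator on the Hilbert space `ℂᴺ` given by a matrix; its norm is the spectral norm. -/
abbrev toOp {N : ℕ} (A : Matrix (Fin N) (Fin N) ℂ) : CN N →L[ℂ] CN N :=
  Matrix.toEuclideanCLM (n := Fin N) (𝕜 := ℂ) A

/-- A matrix weight: locally integrable and almost everywhere positive definite. -/
structure IsMatrixWeight {n N : ℕ} (W : Rn n → Matrix (Fin N) (Fin N) ℂ) : Prop where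
  locallyIntegrable : ∀ i j, LocallyIntegrable (fun x => W x i j) volume
  posDef : ∀ᵐ x ∂(volume : Measure (Rn n)), (W x).PosDef

/-- The half-open cube `Q(z, r) = z + r [-1/2, 1/2)ⁿ`. -/
def cube {n : ℕ} (z : Rn n) (r : ℝ) : Set (Rn n) :=
  {x | ∀ i, z i - r / 2 ≤ x i ∧ x i < z i + r / 2}

/-- The matrix Muckenhoupt constant `[W]_{A_p}` for `0 < p ≤ 1`:
`sup_Q ess sup_{y ∈ Q} |Q|⁻¹ ∫_Q ‖W(t)^{1/p} W(y)^{-1/p}‖^p dt`. -/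
def apConst {n N : ℕ} (p : ℝ) (W : Rn n → Matrix (Fin N) (Fin N) ℂ) : ℝ≥0∞ :=
  ⨆ (z : Rn n) (r : ℝ) (_ : 0 < r),
    essSup (fun y => (volume (cube z r))⁻¹ *
        ∫⁻ t in cube z r, ‖toOp (matPow (W t) (1 / p) * matPow (W y) (-(1 / p)))‖ₑ ^ p)
      (volume.restrict (cube z r))

/-- The scalar weight `w_v(t) = |W(t)^{1/p} v|^p`. -/
def scalarWeight {n N : ℕ} (p : ℝ) (W : Rn n → Matrix (Fin N) (Fin N) ℂ) (v : CN N)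
    (t : Rn n) : ℝ≥0∞ :=
  ‖toOp (matPow (W t) (1 / p)) v‖ₑ ^ p

/-- `β` is the doubling exponent of `W`: `2 ^ β` is the least constant `C` such that
`∫_{Q(z,2r)} w_v ≤ C ∫_{Q(z,r)} w_v` for all vectors `v` and all cubes `Q(z,r)`. -/
def IsDoublingExponent {n N : ℕ} (p : ℝ) (W : Rn n → Matrix (Fin N) (Fin N) ℂ) (β : ℝ) : Prop :=
  IsLeast {C : ℝ≥0∞ | ∀ (v : CN N) (z : Rn n) (r : ℝ), 0 < r →
      ∫⁻ t in cube z (2 * r), scalarWeight p W v t ≤ C * ∫⁻ t in cube z r, scalarWeight p W v t}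
    (ENNReal.ofReal (2 ^ β))

/-- The quasi-norm `‖f‖_{L^p(W)} = (∫ |W^{1/p}(x) f(x)|^p dx)^{1/p}`, with values in `[0, ∞]`. -/
def weightedNorm {n N : ℕ} (p : ℝ) (W : Rn n → Matrix (Fin N) (Fin N) ℂ) (f : Rn n → CN N) :
    ℝ≥0∞ :=
  (∫⁻ x, ‖toOp (matPow (W x) (1 / p)) (f x)‖ₑ ^ p) ^ (1 / p)

/-- Membership in `L^p(W)`. -/
def MemLpW {n N : ℕ} (p : ℝ) (W : Rn n → Matrix (Fin N) (Fin N) ℂ) (f : Rn n → CN N) : Prop :=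
  AEStronglyMeasurable f volume ∧ weightedNorm p W f < ⊤

/-! ### The Fourier transform with the normalisation `(2π)^{-n/2} ∫ f(x) e^{-i x·ξ} dx` -/

/-- The linear change of variables `x ↦ (2π)⁻¹ x`. -/
def scaleEquiv (n : ℕ) : Rn n ≃L[ℝ] Rn n :=
  ContinuousLinearEquiv.smulLeft (Units.mk0 ((2 * Real.pi)⁻¹ : ℝ) (by positivity))

/-- The normalising factor `(2π)^{-n/2}`. -/
def fourierFactor (n : ℕ) : ℂ := (((2 * Real.pi) ^ (-(n : ℝ) / 2) : ℝ) : ℂ)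

/-- The inverse Fourier transform `(2π)^{-n/2} ∫ φ(ξ) e^{i x·ξ} dξ` of an integrable function. -/
def invFourierFun {n : ℕ} (φ : Rn n → ℂ) (x : Rn n) : ℂ :=
  fourierFactor n * ∫ ξ, Complex.exp (Complex.I * (inner ℝ x ξ : ℝ)) * φ ξ

/-- The Fourier transform on Schwartz functions, obtained by rescaling Mathlib's transform
`∫ g(x) e^{-2πi x·ξ} dx`; see `fourierSchwartz_apply`. -/
def fourierSchwartz (n : ℕ) : 𝓢(Rn n, ℂ) →L[ℂ] 𝓢(Rn n, ℂ) :=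
  fourierFactor n • (SchwartzMap.compCLMOfContinuousLinearEquiv ℂ (scaleEquiv n) ∘L
    fourierCLM ℂ 𝓢(Rn n, ℂ))

/-- The inverse Fourier transform on Schwartz functions; see `invFourierSchwartz_apply`. -/
def invFourierSchwartz (n : ℕ) : 𝓢(Rn n, ℂ) →L[ℂ] 𝓢(Rn n, ℂ) :=
  fourierFactor n • (SchwartzMap.compCLMOfContinuousLinearEquiv ℂ (scaleEquiv n) ∘L
    fourierInvCLM ℂ 𝓢(Rn n, ℂ))

theorem fourierSchwartz_apply {n : ℕ} (g : 𝓢(Rn n, ℂ)) (ξ : Rn n) :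
    fourierSchwartz n g ξ =
      fourierFactor n * ∫ x, Complex.exp (-(Complex.I * (inner ℝ x ξ : ℝ))) * g x := by
  have h : ∀ x : Rn n, ((-2 * Real.pi * inner ℝ x ((2 * Real.pi)⁻¹ • ξ) : ℝ) : ℂ) * Complex.I =
      -(Complex.I * (inner ℝ x ξ : ℝ)) := by
    intro x
    rw [real_inner_smul_right]
    have : (-2 * Real.pi * ((2 * Real.pi)⁻¹ * inner ℝ x ξ) : ℝ) = -inner ℝ x ξ := by
      field_simp
    rw [this]
    push_cast
    ring
  have h2 : fourierSchwartz n g ξ =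
      fourierFactor n * 𝓕 (g : Rn n → ℂ) ((2 * Real.pi)⁻¹ • ξ) := rfl
  rw [h2, Real.fourier_eq']
  simp only [smul_eq_mul]
  congr 2
  ext x
  rw [← h x]

theorem invFourierSchwartz_apply {n : ℕ} (g : 𝓢(Rn n, ℂ)) (x : Rn n) :
    invFourierSchwartz n g x = invFourierFun g x := by
  have h : ∀ ξ : Rn n, ((2 * Real.pi * inner ℝ ξ ((2 * Real.pi)⁻¹ • x) : ℝ) : ℂ) * Complex.I =
      Complex.I * (inner ℝ x ξ : ℝ) := by
    intro ξ
    rw [real_inner_smul_right, real_inner_comm]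
    have : (2 * Real.pi * ((2 * Real.pi)⁻¹ * inner ℝ x ξ) : ℝ) = inner ℝ x ξ := by
      field_simp
    rw [this]
    ring
  have h2 : invFourierSchwartz n g x =
      fourierFactor n * 𝓕⁻ (g : Rn n → ℂ) ((2 * Real.pi)⁻¹ • x) := by
    rw [← SchwartzMap.fourierInv_coe]
    rfl
  rw [h2, Real.fourierInv_eq', invFourierFun]
  simp only [smul_eq_mul]
  congr 2
  ext ξ
  rw [← h ξ]

/-- The Fourier transform on tempered distributions, `⟨F T, g⟩ = ⟨T, F g⟩`. -/
def fourierDist {n : ℕ} (T : 𝓢'(Rn n, ℂ)) : 𝓢'(Rn n, ℂ) :=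
  PointwiseConvergenceCLM.precomp ℂ (fourierSchwartz n) T

/-- The inverse Fourier transform on tempered distributions, `⟨F⁻¹ T, g⟩ = ⟨T, F⁻¹ g⟩`. -/
def invFourierDist {n : ℕ} (T : 𝓢'(Rn n, ℂ)) : 𝓢'(Rn n, ℂ) :=
  PointwiseConvergenceCLM.precomp ℂ (invFourierSchwartz n) T

/-! ### Functions as tempered distributions, and band-limited vector functions -/

/-- The tempered distribution `T` is (given by) the locally integrable function `f`. -/
def IsRepresentedBy {n : ℕ} (T : 𝓢'(Rn n, ℂ)) (f : Rn n → ℂ) : Prop :=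
  LocallyIntegrable f volume ∧
    ∀ g : 𝓢(Rn n, ℂ), HasCompactSupport g → T g = ∫ x, g x * f x

/-- The class `E_R`: the coordinates of `f` are tempered distributions whose Fourier transforms are
supported in the open ball `B(0, R)`. -/
def IsBandlimited {n N : ℕ} (R : ℝ) (f : Rn n → CN N) : Prop :=
  ∀ i, ∃ T : 𝓢'(Rn n, ℂ), IsRepresentedBy T (fun x => f x i) ∧
    Distribution.dsupport (fourierDist T) ⊆ Metric.ball 0 R

/-! ### Fourier multipliers -/

/-- The rescaled kernel `ρ_ε(x) = ε^{-n} ρ(x / ε)`. -/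
def dilate {n : ℕ} (ρ : Rn n → ℝ) (ε : ℝ) (x : Rn n) : ℝ := (ε ^ n)⁻¹ * ρ (ε⁻¹ • x)

/-- `P` is the product `φ · U` of the integrable, compactly supported function `φ` and the
tempered distribution `U`: for every mollifier `ρ`, the products `(ρ_ε ∗ φ) · U` of `U` with the
smooth compactly supported functions `ρ_ε ∗ φ` converge to `P` in the space of tempered
distributions as `ε → 0+`. For smooth `φ` this is the usual product. -/
def IsProduct {n : ℕ} (φ : Rn n → ℂ) (U P : 𝓢'(Rn n, ℂ)) : Prop :=
  ∀ ρ : Rn n → ℝ, ContDiff ℝ ∞ ρ → HasCompactSupport ρ → (∀ x, 0 ≤ ρ x) → ∫ x, ρ x = 1 →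
    Tendsto (fun ε : ℝ => TemperedDistribution.smulLeftCLM ℂ
        (convolution (dilate ρ ε) φ (ContinuousLinearMap.lsmul ℝ ℝ) volume) U)
      (𝓝[>] 0) (𝓝 P)

/-- The function `h` is `φ(D) f = F⁻¹[φ · F f]`, in the sense of tempered distributions. -/
def IsMultiplier {n : ℕ} (φ : Rn n → ℂ) (f h : Rn n → ℂ) : Prop :=
  ∃ T P : 𝓢'(Rn n, ℂ), IsRepresentedBy T f ∧ IsProduct φ (fourierDist T) P ∧
    IsRepresentedBy (invFourierDist P) h

end

end MatrixWeight

/-! Up to normalisation, φ(D)f is the convolution of f with Φ = F⁻¹φ, and for p ≤ 1 Nikolskii's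
inequality replaces Minkowski's. For fixed x and a fixed matrix B, the function y ↦ Φ(x - y) B f(y)
is band-limited at scale R, so the p-th power of its L¹ norm is at most a multiple of R^{n(1-p)} ∫
|Φ(x - y)|^p |B f(y)|^p dy (`IsBandlimited.lintegral_mul_enorm_rpow_le`). Take B = W(x)^{1/p},
insert the decay of Φ and integrate in x. By Tonelli it remains to bound ∫ (1 + R|x - y|)^{-(n+1/2)}
|W(x)^{1/p} v|^p dx by a multiple of R^{-n} |W(y)^{1/p} v|^p with v = f(y). For p ≤ 1 the A_p
condition makes every scalar weight |W^{1/p} v|^p an A₁ weight, uniformly in v, and a sum over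
dyadic cubes gives the bound (`ae_lintegral_kernel_mul_scalarWeight_le`). The powers of R, namely
n(1-p) + np - n, cancel. The constant sees neither β nor M because the doubling exponent is always
at least 1/2 (`IsDoublingExponent.half_le`): then Mp > n + 1/2, and only this much decay is used.
Two points are qualitative. A function with spectrum in a ball has polynomial growth
(`exists_norm_apply_le_of_dsupport_subset`), so it becomes integrable after multiplication by a
rapidly decreasing factor of small spectrum; Fatou's lemma then removes the factor from Nikolskii's
inequality. Finiteness of the weighted double integral makes the convolution converge absolutely
with polynomial growth, which identifies it with φ(D)f (`isMultiplier_of_lintegral_le`). -/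

namespace MatrixWeight

/-! ### Normalisation and inversion of the Fourier transform -/

noncomputable section

/-- The unnormalised oscillatory integral `∫ φ(ξ) e^{i x·ξ} dξ`. -/
def oscInt {n : ℕ} (φ : Rn n → ℂ) (x : Rn n) : ℂ :=
  ∫ ξ, Complex.exp (Complex.I * (inner ℝ x ξ : ℝ)) * φ ξ

theorem invFourierFun_eq_oscInt {n : ℕ} (φ : Rn n → ℂ) (x : Rn n) :
    invFourierFun φ x = fourierFactor n * oscInt φ x := rfl

theorem fourierSchwartz_eq_oscInt {n : ℕ} (g : 𝓢(Rn n, ℂ)) (x : Rn n) :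
    fourierSchwartz n g x = fourierFactor n * oscInt g (-x) := by
  rw [fourierSchwartz_apply, oscInt]
  congr 2
  ext ξ
  rw [inner_neg_left, real_inner_comm]
  push_cast
  ring_nf

@[simp]
theorem norm_exp_I_mul (t : ℝ) : ‖Complex.exp (Complex.I * (t : ℂ))‖ = 1 := by
  rw [mul_comm, Complex.norm_exp_ofReal_mul_I]

theorem norm_fourierFactor_le_one (n : ℕ) : ‖fourierFactor n‖ ≤ 1 := by
  rw [fourierFactor, Complex.norm_real, Real.norm_eq_abs, abs_of_nonneg (by positivity)]
  apply Real.rpow_le_one_of_one_le_of_nonpos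
  · have := Real.pi_gt_three
    linarith
  · have : (0 : ℝ) ≤ n := by positivity
    linarith

theorem fourierFactor_mul_self (n : ℕ) :
    fourierFactor n * fourierFactor n * (((2 * Real.pi) ^ n : ℝ) : ℂ) = 1 := by
  rw [fourierFactor, ← Complex.ofReal_mul, ← Complex.ofReal_mul, ← Real.rpow_add (by positivity),
    ← Real.rpow_natCast, ← Real.rpow_add (by positivity)]
  simp

theorem fourierFactor_ne_zero (n : ℕ) : fourierFactor n ≠ 0 := fun h => by
  have := fourierFactor_mul_self n
  simp [h] at this

theorem norm_oscInt_le {n : ℕ} (φ : Rn n → ℂ) (x : Rn n) : ‖oscInt φ x‖ ≤ ∫ ξ, ‖φ ξ‖ := by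
  refine (norm_integral_le_integral_norm _).trans (le_of_eq ?_)
  simp

theorem continuous_exp_I_inner {n : ℕ} (x : Rn n) :
    Continuous fun ξ : Rn n => Complex.exp (Complex.I * (inner ℝ x ξ : ℝ)) := by
  fun_prop

theorem integrable_exp_mul {n : ℕ} {φ : Rn n → ℂ} (hφ : Integrable φ) (x : Rn n) :
    Integrable fun ξ => Complex.exp (Complex.I * (inner ℝ x ξ : ℝ)) * φ ξ := by
  refine hφ.bdd_mul (c := 1) (continuous_exp_I_inner x).aestronglyMeasurable ?_
  exact Eventually.of_forall fun ξ => by simp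

theorem continuous_oscInt {n : ℕ} {φ : Rn n → ℂ} (hφ : Integrable φ) :
    Continuous (oscInt φ) := by
  refine continuous_of_dominated (bound := fun ξ => ‖φ ξ‖)
    (fun x => (integrable_exp_mul hφ x).aestronglyMeasurable)
    (fun x => Eventually.of_forall fun ξ => by simp) hφ.norm ?_
  exact Eventually.of_forall fun ξ => by fun_prop

/-- The Jacobian (2π)^n arising here is what the two factors `fourierFactor n` cancel in the
inversion formulas. -/
theorem fourier_comp_two_pi_inv_smul {n : ℕ} (G : Rn n → ℂ) (ξ : Rn n) :
    𝓕 (fun x : Rn n => G ((2 * Real.pi)⁻¹ • x)) ((2 * Real.pi)⁻¹ • ξ) =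
      (((2 * Real.pi) ^ n : ℝ) : ℂ) * 𝓕 G ξ := by
  rw [Real.fourier_eq, Real.fourier_eq]
  have h := Measure.integral_comp_smul (volume : Measure (Rn n))
    (fun u => Real.fourierChar (-(inner ℝ u ξ)) • G u) (2 * Real.pi)⁻¹
  simp only [inner_smul_left, inner_smul_right] at h ⊢
  simp only [RCLike.conj_to_real] at h
  rw [h]
  simp only [finrank_euclideanSpace_fin, inv_pow, inv_inv]
  rw [abs_of_nonneg (by positivity), Complex.real_smul]

theorem fourierInv_comp_two_pi_inv_smul {n : ℕ} (G : Rn n → ℂ) (ξ : Rn n) :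
    𝓕⁻ (fun x : Rn n => G ((2 * Real.pi)⁻¹ • x)) ((2 * Real.pi)⁻¹ • ξ) =
      (((2 * Real.pi) ^ n : ℝ) : ℂ) * 𝓕⁻ G ξ := by
  rw [Real.fourierInv_eq_fourier_neg, Real.fourierInv_eq_fourier_neg, ← smul_neg,
    fourier_comp_two_pi_inv_smul]

@[simp]
theorem fourierSchwartz_invFourierSchwartz {n : ℕ} (g : 𝓢(Rn n, ℂ)) :
    fourierSchwartz n (invFourierSchwartz n g) = g := by
  ext ξ
  have h1 : fourierSchwartz n (invFourierSchwartz n g) ξ = fourierFactor n * 𝓕 (fun x : Rn n =>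
      (fourierFactor n • (𝓕⁻ g : 𝓢(Rn n, ℂ))) ((2 * Real.pi)⁻¹ • x)) ((2 * Real.pi)⁻¹ • ξ) := rfl
  rw [h1, fourier_comp_two_pi_inv_smul, ← SchwartzMap.fourier_coe, FourierTransform.fourier_smul,
    FourierTransform.fourier_fourierInv_eq, _root_.smul_apply, smul_eq_mul]
  linear_combination g ξ * fourierFactor_mul_self n

@[simp]
theorem invFourierSchwartz_fourierSchwartz {n : ℕ} (g : 𝓢(Rn n, ℂ)) :
    invFourierSchwartz n (fourierSchwartz n g) = g := by
  ext ξ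
  have h1 : invFourierSchwartz n (fourierSchwartz n g) ξ = fourierFactor n * 𝓕⁻ (fun x : Rn n =>
      (fourierFactor n • (𝓕 g : 𝓢(Rn n, ℂ))) ((2 * Real.pi)⁻¹ • x)) ((2 * Real.pi)⁻¹ • ξ) := by
    have h2 : invFourierSchwartz n (fourierSchwartz n g) ξ = fourierFactor n *
        (𝓕⁻ (fourierSchwartz n g) : 𝓢(Rn n, ℂ)) ((2 * Real.pi)⁻¹ • ξ) := rfl
    rw [h2, SchwartzMap.fourierInv_coe]
    rfl
  rw [h1, fourierInv_comp_two_pi_inv_smul, ← SchwartzMap.fourierInv_coe,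
    FourierTransform.fourierInv_smul,
    FourierTransform.fourierInv_fourier_eq, _root_.smul_apply, smul_eq_mul]
  linear_combination g ξ * fourierFactor_mul_self n

end

/-! ### Nikolskii's inequality for integrable functions -/

noncomputable section

variable {n : ℕ} {E : Type*} [NormedAddCommGroup E] [NormedSpace ℂ E]

theorem integrable_exp_smul {G : Rn n → E} (hG : Integrable G) (ξ : Rn n) :
    Integrable fun y => Complex.exp (Complex.I * (inner ℝ ξ y : ℝ)) • G y := by
  exact hG.bdd_smul 1 (continuous_exp_I_inner ξ).aestronglyMeasurable
    (Eventually.of_forall fun ξ => by simp)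

variable [CompleteSpace E]

/-- If the Fourier transform of `G` vanishes off the ball of radius `S`, then `G` is, as a
functional on `L¹`, bounded by a multiple of `‖G‖₁`. -/
theorem norm_integral_smul_le_of_oscillatory_eq_zero {G : Rn n → E} (hG : Integrable G) {S : ℝ}
    (hS : ∀ ξ : Rn n, S ≤ ‖ξ‖ → ∫ y, Complex.exp (Complex.I * (inner ℝ ξ y : ℝ)) • G y = 0)
    (g : 𝓢(Rn n, ℂ)) :
    ‖∫ y, g y • G y‖ ≤ volume.real (Metric.ball (0 : Rn n) S) * (∫ y, ‖G y‖) * ∫ y, ‖g y‖ := by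
  set u := invFourierSchwartz n g with hu
  have hui : Integrable u := u.integrable
  have hg : ∀ y, g y = fourierFactor n * oscInt u (-y) := by
    intro y
    rw [← fourierSchwartz_eq_oscInt, hu, fourierSchwartz_invFourierSchwartz]
  have hub : ∀ ξ, ‖u ξ‖ ≤ ∫ y, ‖g y‖ := by
    intro ξ
    rw [hu, invFourierSchwartz_apply, invFourierFun_eq_oscInt, norm_mul]
    calc _ ≤ 1 * ∫ y, ‖g y‖ := by
          gcongr
          · exact norm_fourierFactor_le_one n
          · exact norm_oscInt_le _ _
      _ = _ := one_mul _
  have hprod : Integrable (Function.uncurry fun (y ξ : Rn n) =>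
      (Complex.exp (Complex.I * (inner ℝ (-y) ξ : ℝ)) * u ξ) • G y) (volume.prod volume) := by
    have h1 : Integrable (fun z : Rn n × Rn n => u z.2 • G z.1) (volume.prod volume) :=
      (Integrable.smul_prod hui hG).swap
    have h2 := h1.bdd_smul 
      (φ := fun z : Rn n × Rn n => Complex.exp (Complex.I * (inner ℝ (-z.1) z.2 : ℝ)))
      1 (by apply Continuous.aestronglyMeasurable; fun_prop)
      (Eventually.of_forall fun z => by simp only [norm_exp_I_mul, le_refl])
    refine h2.congr (Eventually.of_forall fun z => ?_)
    simp only [Function.uncurry, Pi.smul_apply', smul_smul]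
  -- Since g is the Fourier transform of u, Fubini moves the transform onto G, where it lives on the
  -- ball of radius S. There |u| is at most ‖g‖₁ and the transform of G at most ‖G‖₁.
  have key : ∫ y, g y • G y = fourierFactor n • ∫ ξ, u ξ •
      ∫ y, Complex.exp (Complex.I * (inner ℝ (-ξ) y : ℝ)) • G y := by
    calc ∫ y, g y • G y = ∫ y, fourierFactor n • ∫ ξ,
          (Complex.exp (Complex.I * (inner ℝ (-y) ξ : ℝ)) * u ξ) • G y := by
          congr 1
          ext1 y
          rw [integral_smul_const, smul_smul, hg y, oscInt]
      _ = fourierFactor n • ∫ ξ, ∫ y,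
          (Complex.exp (Complex.I * (inner ℝ (-y) ξ : ℝ)) * u ξ) • G y := by
          rw [integral_smul, integral_integral_swap hprod]
      _ = _ := by
          congr 2
          ext1 ξ
          rw [← integral_smul]
          congr 1
          ext1 y
          rw [smul_smul, mul_comm, inner_neg_left, inner_neg_left, real_inner_comm]
  have hbound : ∀ ξ, ‖u ξ • ∫ y, Complex.exp (Complex.I * (inner ℝ (-ξ) y : ℝ)) • G y‖ ≤
      (Metric.ball (0 : Rn n) S).indicator (fun _ => (∫ y, ‖g y‖) * ∫ y, ‖G y‖) ξ := by
    intro ξ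
    by_cases hξ : ξ ∈ Metric.ball (0 : Rn n) S
    · rw [Set.indicator_of_mem hξ, norm_smul]
      gcongr
      · exact hub ξ
      · refine (norm_integral_le_integral_norm _).trans (le_of_eq ?_)
        simp only [norm_smul, norm_exp_I_mul, one_mul]
    · rw [Set.indicator_of_notMem hξ, hS, smul_zero, norm_zero]
      simpa using hξ
  have hind : Integrable ((Metric.ball (0 : Rn n) S).indicator
      (fun _ => (∫ y, ‖g y‖) * ∫ y, ‖G y‖)) := by
    rw [integrable_indicator_iff measurableSet_ball]
    exact integrableOn_const (measure_ball_lt_top.ne)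
  calc ‖∫ y, g y • G y‖ ≤ 1 * ∫ ξ, (Metric.ball (0 : Rn n) S).indicator
        (fun _ => (∫ y, ‖g y‖) * ∫ y, ‖G y‖) ξ := by
        rw [key, norm_smul]
        gcongr
        · exact norm_fourierFactor_le_one n
        · exact norm_integral_le_of_norm_le hind (Eventually.of_forall hbound)
    _ = _ := by
        rw [integral_indicator measurableSet_ball, setIntegral_const, smul_eq_mul]
        ring

/-- A locally integrable function that is dominated by a continuous function as a functional on
nonnegative test functions is dominated by it almost everywhere. -/
theorem ae_norm_le_of_forall_norm_integral_smul_le {F : Type*} [NormedAddCommGroup F]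
    [NormedSpace ℝ F] [CompleteSpace F] {f : Rn n → F} (hf : LocallyIntegrable f)
    {w : Rn n → ℝ} (hw : Continuous w)
    (h : ∀ g : Rn n → ℝ, ContDiff ℝ ∞ g → HasCompactSupport g → (∀ x, 0 ≤ g x) →
      ‖∫ x, g x • f x‖ ≤ ∫ x, w x * g x) :
    ∀ᵐ x, ‖f x‖ ≤ w x := by
  -- The radii shrink with fixed ratio two, as Lebesgue differentiation along these bumps requires.
  let b : ℕ → ContDiffBump (0 : Rn n) := fun k =>
    { rIn := 1 / ((k : ℝ) + 1), rOut := 2 * (1 / ((k : ℝ) + 1)), rIn_pos := by positivity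
      rIn_lt_rOut := by
        have : 0 < 1 / ((k : ℝ) + 1) := by positivity
        linarith }
  have hb : Tendsto (fun k => (b k).rOut) atTop (𝓝 0) := by
    have := (tendsto_one_div_add_atTop_nhds_zero_nat (𝕜 := ℝ)).const_mul 2
    rwa [mul_zero] at this
  have hb' : ∀ᶠ k in atTop, (b k).rOut ≤ 2 * (b k).rIn := Eventually.of_forall fun k => le_rfl
  filter_upwards [ContDiffBump.ae_convolution_tendsto_right_of_locallyIntegrable
    (μ := (volume : Measure (Rn n))) hb hb' hf] with x hx
  have hwx := ContDiffBump.convolution_tendsto_right_of_continuous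
    (μ := (volume : Measure (Rn n))) hb hw x
  refine le_of_tendsto_of_tendsto hx.norm hwx (Eventually.of_forall fun k => ?_)
  simp only [convolution_eq_swap, ContinuousLinearMap.lsmul_apply]
  refine (h (fun t => (b k).normed volume (x - t)) ?_ ?_ ?_).trans (le_of_eq ?_)
  · exact (b k).contDiff_normed.comp (contDiff_const.sub contDiff_id)
  · exact ((b k).hasCompactSupport_normed).comp_homeomorph (Homeomorph.subLeft x)
  · exact fun t => (b k).nonneg_normed _
  · simp only [smul_eq_mul, mul_comm]

/-- Write u = u^{1-p} u^p, bound the first factor by (V ∫ u)^{1-p} and divide by (∫ u)^{1-p}. The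
division needs ∫ u to be finite, which is why non-integrable functions are later approximated first.
-/
theorem lintegral_rpow_le_of_ae_le {α : Type*} [MeasurableSpace α] {μ : Measure α}
    {u : α → ℝ≥0∞} {V : ℝ≥0∞} {p : ℝ} (hp0 : 0 < p) (hp1 : p ≤ 1) (hV : V ≠ ⊤)
    (hI : ∫⁻ x, u x ∂μ ≠ ⊤) (h : ∀ᵐ x ∂μ, u x ≤ V * ∫⁻ y, u y ∂μ) :
    (∫⁻ x, u x ∂μ) ^ p ≤ V ^ (1 - p) * ∫⁻ x, u x ^ p ∂μ := by
  set I := ∫⁻ x, u x ∂μ with hIdef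
  rcases eq_or_ne I 0 with h0 | h0
  · rw [h0, ENNReal.zero_rpow_of_pos hp0]
    exact zero_le
  have hVI : V ^ (1 - p) ≠ ⊤ := ENNReal.rpow_ne_top_of_nonneg (by linarith) hV
  have hII : I ^ (1 - p) ≠ ⊤ := ENNReal.rpow_ne_top_of_nonneg (by linarith) hI
  have hI0 : I ^ (1 - p) ≠ 0 := by
    rw [Ne, ENNReal.rpow_eq_zero_iff]
    grind
  have h1 : I ≤ (V ^ (1 - p) * I ^ (1 - p)) * ∫⁻ x, u x ^ p ∂μ := by
    rw [← lintegral_const_mul' _ _ (ENNReal.mul_ne_top hVI hII), hIdef]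
    refine lintegral_mono_ae ?_
    filter_upwards [h] with x hx
    calc u x = u x ^ (1 - p) * u x ^ p := by
          rw [← ENNReal.rpow_add_of_nonneg _ _ (by linarith) hp0.le]
          simp
      _ ≤ (V * I) ^ (1 - p) * u x ^ p := by
          gcongr
      _ = _ := by rw [ENNReal.mul_rpow_of_nonneg _ _ (by linarith)]
  have h2 : I = I ^ (1 - p) * I ^ p := by
    rw [← ENNReal.rpow_add_of_nonneg _ _ (by linarith) hp0.le]
    simp
  rw [← ENNReal.mul_le_mul_iff_right hI0 hII, ← h2]
  calc _ ≤ _ := h1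
    _ = _ := by ring

/-- **Nikolskii's inequality** between `L¹` and `Lᵖ`, `0 < p ≤ 1`, for integrable functions with
Fourier transform supported in a ball. -/
theorem lintegral_enorm_rpow_le_of_oscillatory_eq_zero {G : Rn n → E}
    (hG : Integrable G) {S : ℝ}
    (hS : ∀ ξ : Rn n, S ≤ ‖ξ‖ → ∫ y, Complex.exp (Complex.I * (inner ℝ ξ y : ℝ)) • G y = 0)
    {p : ℝ} (hp0 : 0 < p) (hp1 : p ≤ 1) :
    (∫⁻ y, ‖G y‖ₑ) ^ p ≤ volume (Metric.ball (0 : Rn n) S) ^ (1 - p) * ∫⁻ y, ‖G y‖ₑ ^ p := by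
  let _ : NormedSpace ℝ E := NormedSpace.restrictScalars ℝ ℂ E
  refine lintegral_rpow_le_of_ae_le hp0 hp1 measure_ball_lt_top.ne hG.2.ne ?_
  have h := ae_norm_le_of_forall_norm_integral_smul_le hG.locallyIntegrable
    (w := fun _ => volume.real (Metric.ball (0 : Rn n) S) * ∫ y, ‖G y‖) continuous_const ?_
  · filter_upwards [h] with y hy
    rw [← ofReal_norm]
    refine (ENNReal.ofReal_le_ofReal hy).trans (le_of_eq ?_)
    rw [ENNReal.ofReal_mul measureReal_nonneg, ofReal_integral_norm_eq_lintegral_enorm hG,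
      ofReal_measureReal measure_ball_lt_top.ne]
  · intro g hg hgc hg0
    let g' : 𝓢(Rn n, ℂ) := HasCompactSupport.toSchwartzMap
      (f := fun x => (g x : ℂ)) (hgc.comp_left (g := Complex.ofReal) Complex.ofReal_zero)
      (Complex.ofRealCLM.contDiff.comp hg)
    have h1 := norm_integral_smul_le_of_oscillatory_eq_zero hG hS g'
    have h2 : ∀ x, g' x = (g x : ℂ) := fun x => rfl
    simp only [h2, Complex.norm_real, Real.norm_of_nonneg (hg0 _), Complex.coe_smul] at h1
    rw [integral_const_mul]
    exact h1

end

noncomputable section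

variable {n : ℕ}

/-! ### Truncation of Schwartz functions -/

/-- A smooth compactly supported cutoff function equal to one on the unit ball. -/
def cutoff (n : ℕ) (x : Rn n) : ℂ :=
  ((⟨1, 2, one_pos, one_lt_two⟩ : ContDiffBump (0 : Rn n)) x : ℝ)

theorem contDiff_cutoff : ContDiff ℝ ∞ (cutoff n) :=
  Complex.ofRealCLM.contDiff.comp (ContDiffBump.contDiff _)

theorem hasCompactSupport_cutoff : HasCompactSupport (cutoff n) :=
  (ContDiffBump.hasCompactSupport _).comp_left (g := Complex.ofReal) Complex.ofReal_zero

theorem cutoff_eq_one {x : Rn n} (hx : ‖x‖ ≤ 1) : cutoff n x = 1 := by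
  rw [cutoff, ContDiffBump.one_of_mem_closedBall, Complex.ofReal_one]
  simpa using hx

theorem norm_cutoff_le_one (x : Rn n) : ‖cutoff n x‖ ≤ 1 := by
  rw [cutoff, Complex.norm_real, Real.norm_of_nonneg (ContDiffBump.nonneg _)]
  exact ContDiffBump.le_one _

/-- The function vanishes where |ax| < 1; elsewhere 1 ≤ a|x|, so a bounded derivative may be traded
for a factor a at the cost of one power of |x|, which a Schwartz function absorbs. -/
theorem exists_norm_iteratedFDeriv_cutoff_le (i : ℕ) :
    ∃ B : ℝ, 0 ≤ B ∧ ∀ a : ℝ, 0 < a → a ≤ 1 → ∀ x : Rn n,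
      ‖iteratedFDeriv ℝ i (fun x => cutoff n (a • x) - 1) x‖ ≤ B * a * ‖x‖ := by
  let θ : 𝓢(Rn n, ℂ) := hasCompactSupport_cutoff.toSchwartzMap contDiff_cutoff
  refine ⟨SchwartzMap.seminorm ℝ 0 i θ + 1, by positivity, fun a ha ha1 x => ?_⟩
  have hη : ContDiff ℝ i (fun x => cutoff n x - 1) :=
    (contDiff_cutoff.sub contDiff_const).of_le (mod_cast le_top)
  rw [congrFun (iteratedFDeriv_comp_const_smul a hη) x, norm_smul]
  rcases lt_or_ge ‖a • x‖ 1 with h | h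
  · have : (fun x => cutoff n x - 1) =ᶠ[𝓝 (a • x)] fun _ => 0 := by
      filter_upwards [Metric.isOpen_ball.mem_nhds (by simpa using h : a • x ∈ Metric.ball 0 1)]
        with y hy
      rw [cutoff_eq_one (by simpa using (Metric.mem_ball.1 hy).le), sub_self]
    rw [(this.iteratedFDeriv ℝ i).eq_of_nhds]
    simp only [iteratedFDeriv_fun_zero, Pi.zero_apply, norm_zero, mul_zero]
    positivity
  · rw [norm_smul, Real.norm_of_nonneg ha.le] at h
    have h1 : ‖a ^ i‖ ≤ 1 := by
      rw [norm_pow, Real.norm_of_nonneg ha.le]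
      exact pow_le_one₀ ha.le ha1
    have h2 : ‖iteratedFDeriv ℝ i (fun x => cutoff n x - 1) (a • x)‖ ≤
        SchwartzMap.seminorm ℝ 0 i θ + 1 := by
      have h3 := iteratedFDeriv_sub_apply (i := i) (x := a • x) (𝕜 := ℝ)
        (contDiff_cutoff (n := n) |>.of_le (mod_cast le_top)).contDiffAt
        (contDiff_const (c := (1 : ℂ))).contDiffAt
      refine (congrArg norm h3).trans_le ?_
      refine (norm_sub_le _ _).trans (add_le_add (θ.norm_iteratedFDeriv_le_seminorm ℝ i _) ?_)
      rcases eq_or_ne i 0 with rfl | hi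
      · simp
      · simp [iteratedFDeriv_const_of_ne hi]
    calc _ ≤ 1 * (SchwartzMap.seminorm ℝ 0 i θ + 1) := by gcongr
      _ = (SchwartzMap.seminorm ℝ 0 i θ + 1) * 1 := by ring
      _ ≤ (SchwartzMap.seminorm ℝ 0 i θ + 1) * (a * ‖x‖) := by gcongr
      _ = _ := by ring

theorem contDiff_cutoff_smul (a : ℝ) : ContDiff ℝ ∞ fun x => cutoff n (a • x) :=
  contDiff_cutoff.comp (contDiff_const_smul a)

theorem hasCompactSupport_cutoff_smul {a : ℝ} (ha : a ≠ 0) :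
    HasCompactSupport fun x => cutoff n (a • x) :=
  hasCompactSupport_cutoff.comp_smul ha

/-- The product of a Schwartz function with a dilated cutoff. -/
def truncate (a : ℝ) (u : 𝓢(Rn n, ℂ)) : 𝓢(Rn n, ℂ) :=
  SchwartzMap.smulLeftCLM ℂ (fun x => cutoff n (a • x)) u

theorem truncate_apply {a : ℝ} (ha : a ≠ 0) (u : 𝓢(Rn n, ℂ)) (x : Rn n) :
    truncate a u x = cutoff n (a • x) * u x :=
  SchwartzMap.smulLeftCLM_apply_apply
    ((hasCompactSupport_cutoff_smul ha).hasTemperateGrowth (contDiff_cutoff_smul a)) u x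

theorem hasCompactSupport_truncate {a : ℝ} (ha : a ≠ 0) (u : 𝓢(Rn n, ℂ)) :
    HasCompactSupport (truncate a u) := by
  have : ⇑(truncate a u) = fun x => cutoff n (a • x) * u x := funext (truncate_apply ha u)
  rw [this]
  exact (hasCompactSupport_cutoff_smul ha).mul_right

theorem tsupport_truncate_subset {a : ℝ} (ha : a ≠ 0) (u : 𝓢(Rn n, ℂ)) :
    tsupport (truncate a u) ⊆ tsupport u := by
  have : ⇑(truncate a u) = fun x => cutoff n (a • x) * u x := funext (truncate_apply ha u)
  rw [this]
  exact tsupport_mul_subset_right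

theorem exists_seminorm_truncate_sub_le (u : 𝓢(Rn n, ℂ)) (k l : ℕ) :
    ∃ B : ℝ, ∀ a : ℝ, 0 < a → a ≤ 1 →
      SchwartzMap.seminorm ℂ k l (truncate a u - u) ≤ B * a := by
  choose b hb0 hb using exists_norm_iteratedFDeriv_cutoff_le (n := n)
  refine ⟨∑ i ∈ Finset.range (l + 1), l.choose i * b i * SchwartzMap.seminorm ℝ (k + 1) (l - i) u,
    fun a ha ha1 => ?_⟩
  have hfun : ⇑(truncate a u - u) = fun x => (cutoff n (a • x) - 1) * u x := by
    ext x
    rw [sub_apply, truncate_apply ha.ne']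
    ring
  refine SchwartzMap.seminorm_le_bound ℂ k l _
    (mul_nonneg (Finset.sum_nonneg fun i _ => mul_nonneg (mul_nonneg (by positivity) (hb0 i))
      (apply_nonneg _ _)) ha.le) fun x => ?_
  rw [hfun]
  have h1 := norm_iteratedFDeriv_mul_le (n := l) (N := l)
    (f := fun x => cutoff n (a • x) - 1) (g := u)
    (((contDiff_cutoff_smul a).sub contDiff_const).of_le (mod_cast le_top)) (u.smooth l) x le_rfl
  calc _ ≤ ‖x‖ ^ k * _ := mul_le_mul_of_nonneg_left h1 (by positivity)
    _ ≤ _ := by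
      rw [Finset.mul_sum, Finset.sum_mul]
      refine Finset.sum_le_sum fun i _ => ?_
      have h2 := hb i a ha ha1 x
      have h3 := u.le_seminorm ℝ (k + 1) (l - i) x
      calc _ ≤ ‖x‖ ^ k * (l.choose i * (b i * a * ‖x‖) * ‖iteratedFDeriv ℝ (l - i) u x‖) := by
            gcongr
        _ = l.choose i * b i * (‖x‖ ^ (k + 1) * ‖iteratedFDeriv ℝ (l - i) u x‖) * a := by ring
        _ ≤ _ := by
          have := hb0 i
          gcongr

/-- This carries identities known on compactly supported test functions, all that `IsRepresentedBy`
and compactness arguments provide, to every Schwartz function. -/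
theorem tendsto_truncate (u : 𝓢(Rn n, ℂ)) :
    Tendsto (fun j : ℕ => truncate (1 / ((j : ℝ) + 1)) u) atTop (𝓝 u) := by
  rw [(schwartz_withSeminorms ℂ (Rn n) ℂ).tendsto_nhds]
  rintro ⟨k, l⟩ ε hε
  obtain ⟨B, hB⟩ := exists_seminorm_truncate_sub_le u k l
  have h1 : Tendsto (fun j : ℕ => B * (1 / ((j : ℝ) + 1))) atTop (𝓝 0) := by
    have := (tendsto_one_div_add_atTop_nhds_zero_nat (𝕜 := ℝ)).const_mul B
    rwa [mul_zero] at this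
  filter_upwards [h1.eventually (gt_mem_nhds hε)] with j hj
  refine lt_of_le_of_lt (hB _ (by positivity) ?_) hj
  rw [div_le_one (by positivity)]
  have : (0 : ℝ) ≤ j := by positivity
  linarith

/-! ### Vanishing of distributions off their support -/

theorem exists_contDiff_one_nhds {K U : Set (Rn n)} (hK : IsClosed K) (hU : IsOpen U)
    (hKU : K ⊆ U) : ∃ ψ : Rn n → ℂ, ContDiff ℝ ∞ ψ ∧ (∀ᶠ x in 𝓝ˢ K, ψ x = 1) ∧
      tsupport ψ ⊆ U := by
  obtain ⟨V, hV, hKV, hVU⟩ := normal_exists_closure_subset hK hU hKU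
  obtain ⟨f, hf1, hf0, -⟩ := exists_contMDiffMap_one_nhds_of_subset_interior (n := (⊤ : ℕ∞))
    (modelWithCornersSelf ℝ (Rn n)) hK (t := V) (by rwa [hV.interior_eq])
  refine ⟨fun x => (f x : ℂ), Complex.ofRealCLM.contDiff.comp f.contMDiff.contDiff, ?_, ?_⟩
  · filter_upwards [hf1] with x hx
    rw [hx, Complex.ofReal_one]
  · refine (closure_mono fun x hx => ?_).trans hVU
    by_contra h
    exact hx (by simp [hf0 x h])

/-- `T` vanishes on all compactly supported test functions supported in `U`. -/
def VanishesCompactly (T : 𝓢'(Rn n, ℂ)) (U : Set (Rn n)) : Prop :=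
  ∀ u : 𝓢(Rn n, ℂ), HasCompactSupport u → tsupport u ⊆ U → T u = 0

theorem VanishesCompactly.union {T : 𝓢'(Rn n, ℂ)} {U V : Set (Rn n)} (hU : IsOpen U)
    (hV : IsOpen V) (h1 : VanishesCompactly T U) (h2 : VanishesCompactly T V) :
    VanishesCompactly T (U ∪ V) := by
  intro u hc hu
  -- As ψ is one near the part of the support of u outside V, ψu is supported in U and u - ψu in V.
  obtain ⟨ψ, hψ, hψ1, hψU⟩ := exists_contDiff_one_nhds
    ((isClosed_tsupport (f := u)).sdiff hV) hU
    (fun x hx => (hu hx.1).resolve_right hx.2)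
  let a : 𝓢(Rn n, ℂ) := (hc.mul_left (f := ψ)).toSchwartzMap (hψ.mul (u.smooth ⊤))
  have ha : ∀ x, a x = ψ x * u x := fun x => rfl
  have hsplit : u = a + (u - a) := by abel
  rw [hsplit, map_add, h1 a, h2 (u - a), add_zero]
  · exact hc.sub (hc.mul_left (f := ψ))
  · intro x hx
    by_contra hxV
    have hxu : x ∈ tsupport u := by
      refine closure_mono (fun y hy => ?_) hx
      rw [Function.mem_support, sub_apply, ha] at hy
      intro h0
      simp [h0] at hy
    have h3 : ∀ᶠ y in 𝓝 x, ψ y = 1 := eventually_nhdsSet_iff_forall.1 hψ1 x ⟨hxu, hxV⟩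
    have h4 : ⇑(u - a) =ᶠ[𝓝 x] 0 := by
      filter_upwards [h3] with y hy
      rw [sub_apply, ha, hy, one_mul, sub_self, Pi.zero_apply]
    exact notMem_tsupport_iff_eventuallyEq.2 h4 hx
  · exact hc.mul_left (f := ψ)
  · exact (tsupport_mul_subset_left (f := ψ) (g := u)).trans hψU

/-- Off the support T vanishes only near each point; compactness of the support of u and stability
under unions glue finitely many of these neighbourhoods. -/
theorem apply_eq_zero_of_hasCompactSupport {T : 𝓢'(Rn n, ℂ)} {u : 𝓢(Rn n, ℂ)}
    (hc : HasCompactSupport u) (hu : tsupport u ⊆ (Distribution.dsupport T)ᶜ) : T u = 0 := by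
  have key : ∃ U, IsOpen U ∧ tsupport u ⊆ U ∧ VanishesCompactly T U := by
    refine hc.isCompact.induction_on (p := fun s => ∃ U, IsOpen U ∧ s ⊆ U ∧ VanishesCompactly T U)
      ⟨∅, isOpen_empty, subset_rfl, ?_⟩ ?_ ?_ ?_
    · intro v _ hv
      have h0 : v = 0 := by
        ext x
        exact image_eq_zero_of_notMem_tsupport fun h => hv h
      rw [h0, map_zero]
    · rintro s t hst ⟨U, hU, htU, h⟩
      exact ⟨U, hU, hst.trans htU, h⟩
    · rintro s t ⟨U, hU, hsU, h⟩ ⟨V, hV, htV, h'⟩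
      exact ⟨U ∪ V, hU.union hV, Set.union_subset_union hsU htV, h.union hU hV h'⟩
    · intro x hx
      obtain ⟨s, hs, hso, hxs⟩ := (Distribution.notMem_dsupport_iff x).1 (hu hx)
      exact ⟨s, mem_nhdsWithin_of_mem_nhds (hso.mem_nhds hxs), s, hso, subset_rfl,
        fun v _ hv => hs v hv⟩
  obtain ⟨U, -, h1, h2⟩ := key
  exact h2 u hc h1

theorem apply_eq_zero_of_tsupport_subset {T : 𝓢'(Rn n, ℂ)} {u : 𝓢(Rn n, ℂ)}
    (hu : tsupport u ⊆ (Distribution.dsupport T)ᶜ) : T u = 0 := by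
  have h1 : Tendsto (fun j : ℕ => T (truncate (1 / ((j : ℝ) + 1)) u)) atTop (𝓝 (T u)) :=
    (T.continuous.tendsto u).comp (tendsto_truncate u)
  refine tendsto_nhds_unique h1 (tendsto_const_nhds.congr fun j => ?_)
  have hj : 1 / ((j : ℝ) + 1) ≠ 0 := by positivity
  exact (apply_eq_zero_of_hasCompactSupport (hasCompactSupport_truncate hj u)
    ((tsupport_truncate_subset hj u).trans hu)).symm

end

noncomputable section

variable {n : ℕ}

/-! ### Functions of polynomial growth as tempered distributions -/

/-- The n + 1 spare powers of decay leave an integrable majorant, so weighted L¹ norms are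
controlled by Schwartz seminorms. -/
theorem exists_one_add_pow_mul_norm_le (L : ℕ) : ∃ (s : Finset (ℕ × ℕ)) (B : ℝ), 0 ≤ B ∧
    ∀ (g : 𝓢(Rn n, ℂ)) (x : Rn n), (1 + ‖x‖) ^ L * ‖g x‖ ≤
      B * s.sup (schwartzSeminormFamily ℂ (Rn n) ℂ) g * (1 + ‖x‖) ^ (-((n + 1 : ℕ) : ℝ)) := by
  refine ⟨Finset.Iic (L + (n + 1), 0), 2 ^ (L + (n + 1)), by positivity, fun g x => ?_⟩
  have h := SchwartzMap.one_add_le_sup_seminorm_apply (𝕜 := ℂ) (m := (L + (n + 1), 0))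
    (k := L + (n + 1)) (n := 0) le_rfl le_rfl g x
  rw [norm_iteratedFDeriv_zero] at h
  have hx : (0 : ℝ) < 1 + ‖x‖ := by positivity
  rw [Real.rpow_neg hx.le, Real.rpow_natCast, ← div_eq_mul_inv, le_div_iff₀ (by positivity)]
  calc _ = (1 + ‖x‖) ^ (L + (n + 1)) * ‖g x‖ := by rw [pow_add]; ring
    _ ≤ _ := h

theorem integrable_one_add_norm_rpow_neg :
    Integrable fun x : Rn n => (1 + ‖x‖) ^ (-((n + 1 : ℕ) : ℝ)) := by
  apply integrable_one_add_norm
  rw [finrank_euclideanSpace_fin]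
  push_cast
  linarith

theorem integrable_one_add_pow_mul_norm (L : ℕ) (g : 𝓢(Rn n, ℂ)) :
    Integrable fun x => (1 + ‖x‖) ^ L * ‖g x‖ := by
  obtain ⟨s, B, -, hB⟩ := exists_one_add_pow_mul_norm_le (n := n) L
  refine (integrable_one_add_norm_rpow_neg.const_mul
    (B * s.sup (schwartzSeminormFamily ℂ (Rn n) ℂ) g)).mono' ?_ (Eventually.of_forall fun x => ?_)
  · have := g.continuous
    apply Continuous.aestronglyMeasurable
    fun_prop
  · rw [Real.norm_of_nonneg (by positivity)]
    exact hB g x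

theorem norm_smul_le_of_growth {F : Type*} [NormedAddCommGroup F] [NormedSpace ℂ F]
    {f : Rn n → F} {C : ℝ} {L : ℕ} (hC : ∀ᵐ x, ‖f x‖ ≤ C * (1 + ‖x‖) ^ L) (g : 𝓢(Rn n, ℂ)) :
    ∀ᵐ x, ‖g x • f x‖ ≤ C * ((1 + ‖x‖) ^ L * ‖g x‖) := by
  filter_upwards [hC] with x hx
  rw [norm_smul]
  calc _ ≤ ‖g x‖ * (C * (1 + ‖x‖) ^ L) := by gcongr
    _ = _ := by ring

theorem integrable_smul_of_growth {F : Type*} [NormedAddCommGroup F] [NormedSpace ℂ F]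
    {f : Rn n → F} (hf : AEStronglyMeasurable f volume) {C : ℝ} {L : ℕ}
    (hC : ∀ᵐ x, ‖f x‖ ≤ C * (1 + ‖x‖) ^ L) (g : 𝓢(Rn n, ℂ)) :
    Integrable fun x => g x • f x :=
  ((integrable_one_add_pow_mul_norm L g).const_mul C).mono'
    (g.continuous.aestronglyMeasurable.smul hf) (norm_smul_le_of_growth hC g)

theorem exists_temperedDistribution_of_growth {f : Rn n → ℂ}
    (hf : AEStronglyMeasurable f volume) {C : ℝ} {L : ℕ}
    (hC : ∀ᵐ x, ‖f x‖ ≤ C * (1 + ‖x‖) ^ L) :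
    ∃ T : 𝓢'(Rn n, ℂ), ∀ g : 𝓢(Rn n, ℂ), T g = ∫ x, g x * f x := by
  have hint : ∀ g : 𝓢(Rn n, ℂ), Integrable fun x => g x * f x :=
    fun g => integrable_smul_of_growth hf hC g
  obtain ⟨s, B, hB0, hB⟩ := exists_one_add_pow_mul_norm_le (n := n) L
  refine ⟨ContinuousLinearMap.toPointwiseConvergenceCLM _ _ _ _
    (SchwartzMap.mkCLMtoNormedSpace (𝕜 := ℂ) (𝕜' := ℂ) (σ := RingHom.id ℂ)
      (fun g : 𝓢(Rn n, ℂ) => ∫ x, g x * f x) (fun g h => ?_) (fun a g => ?_)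
      ⟨s, |C| * B * ∫ x : Rn n, (1 + ‖x‖) ^ (-((n + 1 : ℕ) : ℝ)), ?_, fun g => ?_⟩),
    fun g => rfl⟩
  · rw [← integral_add (hint g) (hint h)]
    congr 1
    ext x
    rw [_root_.add_apply, add_mul]
  · rw [RingHom.id_apply, smul_eq_mul, ← integral_const_mul]
    congr 1
    ext x
    rw [_root_.smul_apply, smul_eq_mul, mul_assoc]
  · exact mul_nonneg (by positivity) (integral_nonneg fun x => by positivity)
  · have h1 : ∀ᵐ x, ‖g x * f x‖ ≤ (|C| * B * s.sup (schwartzSeminormFamily ℂ (Rn n) ℂ) g) *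
        (1 + ‖x‖) ^ (-((n + 1 : ℕ) : ℝ)) := by
      filter_upwards [norm_smul_le_of_growth hC g] with x hx
      calc _ ≤ C * ((1 + ‖x‖) ^ L * ‖g x‖) := hx
        _ ≤ |C| * ((1 + ‖x‖) ^ L * ‖g x‖) := by
          gcongr
          exact le_abs_self C
        _ ≤ |C| * _ := mul_le_mul_of_nonneg_left (hB g x) (abs_nonneg C)
        _ = _ := by ring
    refine (norm_integral_le_of_norm_le (integrable_one_add_norm_rpow_neg.const_mul _) h1).trans
      (le_of_eq ?_)
    rw [integral_const_mul]
    ring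

/-- The bilinear form whose associated Fourier integral is `oscInt`. -/
def phaseForm (n : ℕ) : Rn n →L[ℝ] Rn n →L[ℝ] ℝ := (-(2 * Real.pi)⁻¹ : ℝ) • innerSL ℝ

theorem fourierIntegral_phaseForm (g : Rn n → ℂ) :
    VectorFourier.fourierIntegral Real.fourierChar volume (phaseForm n).toLinearMap₁₂ g =
      oscInt g := by
  ext x
  rw [VectorFourier.fourierIntegral, oscInt]
  congr 1
  ext ξ
  rw [Circle.smul_def, Real.fourierChar_apply, smul_eq_mul]
  congr 2
  have h : (phaseForm n).toLinearMap₁₂ ξ x = -(2 * Real.pi)⁻¹ * inner ℝ x ξ := by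
    rw [real_inner_comm]
    rfl
  rw [h]
  have h2 : 2 * Real.pi * -(-(2 * Real.pi)⁻¹ * inner ℝ x ξ) = inner ℝ x ξ := by
    field_simp
  rw [h2, mul_comm]

/-- Differentiating under the integral only brings down powers of ξ, so no derivative of g enters.
This turns the finite order of a distribution into polynomial growth of its transform. -/
theorem norm_iteratedFDeriv_oscInt_le (j : ℕ) : ∃ B : ℝ, 0 ≤ B ∧
    ∀ (g : 𝓢(Rn n, ℂ)) (x : Rn n), ‖iteratedFDeriv ℝ j (oscInt g) x‖ ≤
      B * ∫ ξ, (1 + ‖ξ‖) ^ j * ‖g ξ‖ := by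
  have hint : ∀ (g : 𝓢(Rn n, ℂ)) (i : ℕ), Integrable fun ξ => (1 + ‖ξ‖) ^ i * ‖g ξ‖ :=
    fun g i => integrable_one_add_pow_mul_norm i g
  refine ⟨(2 * Real.pi * ‖phaseForm n‖) ^ j * (j + 1), by positivity, fun g x => ?_⟩
  have h := VectorFourier.pow_mul_norm_iteratedFDeriv_fourierIntegral_le (phaseForm n)
    (f := g) (μ := volume) (K := (⊤ : ℕ∞)) (N := (0 : ℕ∞)) (g.smooth 0)
    (fun k m _ _ => g.integrable_pow_mul_iteratedFDeriv volume k m) (k := j) (n := 0)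
    le_top (by simp) (0 : Rn n) x
  rw [fourierIntegral_phaseForm] at h
  simp only [pow_zero, one_mul, mul_one, zero_add, Finset.range_one, Finset.product_singleton,
    Finset.sum_map, Function.Embedding.coeFn_mk, norm_iteratedFDeriv_zero] at h
  rw [mul_assoc]
  refine h.trans (mul_le_mul_of_nonneg_left ?_ (by positivity))
  calc ∑ i ∈ Finset.range (j + 1), ∫ ξ, ‖ξ‖ ^ i * ‖g ξ‖
      ≤ ∑ i ∈ Finset.range (j + 1), ∫ ξ, (1 + ‖ξ‖) ^ j * ‖g ξ‖ := by
        refine Finset.sum_le_sum fun i hi => ?_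
        refine integral_mono (g.integrable_pow_mul volume i) (hint g j) fun ξ => ?_
        have h1 : (1 : ℝ) ≤ 1 + ‖ξ‖ := by linarith [norm_nonneg ξ]
        have h2 : i ≤ j := Nat.lt_succ_iff.1 (Finset.mem_range.1 hi)
        dsimp only
        gcongr ?_ * _
        calc ‖ξ‖ ^ i ≤ (1 + ‖ξ‖) ^ i := by
              gcongr
              linarith
          _ ≤ _ := pow_le_pow_right₀ h1 h2
    _ = _ := by simp

theorem norm_iteratedFDeriv_invFourierSchwartz_le (j : ℕ) : ∃ B : ℝ, 0 ≤ B ∧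
    ∀ (g : 𝓢(Rn n, ℂ)) (x : Rn n), ‖iteratedFDeriv ℝ j (invFourierSchwartz n g) x‖ ≤
      B * ∫ ξ, (1 + ‖ξ‖) ^ j * ‖g ξ‖ := by
  obtain ⟨B, hB0, hB⟩ := norm_iteratedFDeriv_oscInt_le (n := n) j
  refine ⟨‖fourierFactor n‖ * B, by positivity, fun g x => ?_⟩
  have hosc : oscInt g = fun x => (fourierFactor n)⁻¹ • invFourierSchwartz n g x := by
    have h0 := fourierFactor_ne_zero n
    ext x
    rw [invFourierSchwartz_apply, invFourierFun_eq_oscInt, smul_eq_mul, inv_mul_cancel_left₀ h0]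
  have hsm : ContDiff ℝ j (oscInt g) := by
    rw [hosc]
    exact ((invFourierSchwartz n g).smooth j).const_smul (fourierFactor n)⁻¹
  have h1 : ⇑(invFourierSchwartz n g) = fourierFactor n • oscInt g := by
    ext x
    rw [invFourierSchwartz_apply, invFourierFun_eq_oscInt, Pi.smul_apply, smul_eq_mul]
  rw [h1, iteratedFDeriv_const_smul_apply hsm.contDiffAt, norm_smul, mul_assoc]
  gcongr
  exact hB g x

/-- A distribution whose Fourier transform is supported in a ball is continuous with respect to
some polynomially weighted `L¹` norm. -/
theorem exists_norm_apply_le_of_dsupport_subset {T : 𝓢'(Rn n, ℂ)} {R : ℝ}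
    (hT : Distribution.dsupport (fourierDist T) ⊆ Metric.ball 0 R) :
    ∃ (C : ℝ) (L : ℕ), 0 ≤ C ∧ ∀ g : 𝓢(Rn n, ℂ), ‖T g‖ ≤ C * ∫ x, (1 + ‖x‖) ^ L * ‖g x‖ := by
  set U := fourierDist T with hU
  obtain ⟨ψ, hψ, hψ1, hψc⟩ := exists_contDiff_one_nhds
    (Metric.isClosed_closedBall (x := (0 : Rn n)) (ε := R)) Metric.isOpen_ball
    (Metric.closedBall_subset_ball (lt_add_one R))
  have hψcs : HasCompactSupport ψ := (isCompact_closedBall (0 : Rn n) (R + 1)).of_isClosed_subset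
    (isClosed_tsupport ψ) (hψc.trans Metric.ball_subset_closedBall)
  let χ : 𝓢(Rn n, ℂ) := hψcs.toSchwartzMap hψ
  let P : 𝓢(Rn n, ℂ) →L[ℂ] 𝓢(Rn n, ℂ) := SchwartzMap.smulLeftCLM ℂ ψ
  have hP : ∀ u x, P u x = ψ x * u x :=
    fun u x => SchwartzMap.smulLeftCLM_apply_apply (hψcs.hasTemperateGrowth hψ) u x
  -- Since ψ is one near the support of U = F T, inserting it changes nothing. The seminorms
  -- bounding U then see a compactly supported function, and only derivatives of F⁻¹g remain to be
  -- estimated.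
  have hTU : ∀ g, T g = U (P (invFourierSchwartz n g)) := by
    intro g
    have h1 : T g = U (invFourierSchwartz n g) := by
      change _ = T (fourierSchwartz n _)
      rw [fourierSchwartz_invFourierSchwartz]
    rw [h1, ← sub_eq_zero, ← map_sub]
    refine apply_eq_zero_of_tsupport_subset fun x hx hxd => ?_
    have hxK : x ∈ Metric.closedBall (0 : Rn n) R := Metric.ball_subset_closedBall (hT hxd)
    refine notMem_tsupport_iff_eventuallyEq.2 ?_ hx
    filter_upwards [eventually_nhdsSet_iff_forall.1 hψ1 x hxK] with y hy
    rw [sub_apply, hP, hy, one_mul, sub_self, Pi.zero_apply]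
  let q : Seminorm ℂ 𝓢(Rn n, ℂ) := (normSeminorm ℂ ℂ).comp (U : 𝓢(Rn n, ℂ) →ₗ[ℂ] ℂ)
  have hq : Continuous q := continuous_norm.comp U.continuous
  obtain ⟨s, B, -, hB⟩ := Seminorm.bound_of_continuous (schwartz_withSeminorms ℂ (Rn n) ℂ) q hq
  choose b hb0 hb using norm_iteratedFDeriv_invFourierSchwartz_le (n := n)
  let L := s.sup Prod.snd
  let c : ℕ × ℕ → ℝ := fun m => ∑ i ∈ Finset.range (m.2 + 1),
    m.2.choose i * SchwartzMap.seminorm ℝ m.1 i χ * b (m.2 - i)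
  have hc : ∀ m, 0 ≤ c m := fun m => Finset.sum_nonneg fun i _ =>
    mul_nonneg (mul_nonneg (by positivity) (apply_nonneg _ _)) (hb0 _)
  refine ⟨B * ∑ m ∈ s, c m, L, mul_nonneg B.2 (Finset.sum_nonneg fun m _ => hc m), fun g => ?_⟩
  have hI : 0 ≤ ∫ x, (1 + ‖x‖) ^ L * ‖g x‖ := integral_nonneg fun x => by positivity
  have key : ∀ m ∈ s, SchwartzMap.seminorm ℂ m.1 m.2 (P (invFourierSchwartz n g)) ≤
      c m * ∫ x, (1 + ‖x‖) ^ L * ‖g x‖ := by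
    intro m hm
    refine SchwartzMap.seminorm_le_bound ℂ m.1 m.2 _ (mul_nonneg (hc m) hI) fun x => ?_
    have hfun : ⇑(P (invFourierSchwartz n g)) = fun x => χ x * invFourierSchwartz n g x :=
      funext (hP _)
    rw [hfun]
    have h1 := norm_iteratedFDeriv_mul_le (n := m.2) (N := m.2) (χ.smooth m.2)
      ((invFourierSchwartz n g).smooth m.2) x le_rfl
    calc _ ≤ ‖x‖ ^ m.1 * _ := mul_le_mul_of_nonneg_left h1 (by positivity)
      _ ≤ _ := by
        rw [Finset.mul_sum, Finset.sum_mul]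
        refine Finset.sum_le_sum fun i _ => ?_
        have h2 := χ.le_seminorm ℝ m.1 i x
        have h3 : ‖iteratedFDeriv ℝ (m.2 - i) (invFourierSchwartz n g) x‖ ≤
            b (m.2 - i) * ∫ x, (1 + ‖x‖) ^ L * ‖g x‖ := by
          refine (hb _ g x).trans (mul_le_mul_of_nonneg_left ?_ (hb0 _))
          refine integral_mono (integrable_one_add_pow_mul_norm _ g)
            (integrable_one_add_pow_mul_norm _ g) fun ξ => ?_
          have h4 : (1 : ℝ) ≤ 1 + ‖ξ‖ := by linarith [norm_nonneg ξ]
          have h5 : m.2 - i ≤ L := (Nat.sub_le _ _).trans (Finset.le_sup (f := Prod.snd) hm)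
          dsimp only
          gcongr ?_ * _
          exact pow_le_pow_right₀ h4 h5
        calc _ = m.2.choose i * (‖x‖ ^ m.1 * ‖iteratedFDeriv ℝ i χ x‖) *
              ‖iteratedFDeriv ℝ (m.2 - i) (invFourierSchwartz n g) x‖ := by ring
          _ ≤ m.2.choose i * SchwartzMap.seminorm ℝ m.1 i χ *
              (b (m.2 - i) * ∫ x, (1 + ‖x‖) ^ L * ‖g x‖) := by gcongr
          _ = _ := by ring
  rw [hTU]
  calc ‖U (P (invFourierSchwartz n g))‖
      ≤ B * s.sup (schwartzSeminormFamily ℂ (Rn n) ℂ) (P (invFourierSchwartz n g)) := hB _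
    _ ≤ B * ((∑ m ∈ s, c m) * ∫ x, (1 + ‖x‖) ^ L * ‖g x‖) := by
        refine mul_le_mul_of_nonneg_left ?_ B.2
        refine Seminorm.finset_sup_apply_le
          (mul_nonneg (Finset.sum_nonneg fun m _ => hc m) hI) fun m hm => (key m hm).trans ?_
        gcongr
        exact Finset.single_le_sum (fun m _ => hc m) hm
    _ = _ := by ring

/-- A locally integrable function representing a distribution that is continuous in a weighted `L¹`
norm has polynomial growth, and represents the distribution on all Schwartz functions. -/
theorem IsRepresentedBy.growth {T : 𝓢'(Rn n, ℂ)} {f : Rn n → ℂ} (hTf : IsRepresentedBy T f)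
    {C : ℝ} {L : ℕ}
    (hT : ∀ g : 𝓢(Rn n, ℂ), ‖T g‖ ≤ C * ∫ x, (1 + ‖x‖) ^ L * ‖g x‖) :
    (∀ᵐ x, ‖f x‖ ≤ C * (1 + ‖x‖) ^ L) ∧ ∀ g : 𝓢(Rn n, ℂ), T g = ∫ x, g x * f x := by
  have hgr : ∀ᵐ x, ‖f x‖ ≤ C * (1 + ‖x‖) ^ L := by
    refine ae_norm_le_of_forall_norm_integral_smul_le hTf.1 (by fun_prop) fun g hg hgc hg0 => ?_
    have hgc' : HasCompactSupport fun x => (g x : ℂ) :=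
      hgc.comp_left (g := Complex.ofReal) Complex.ofReal_zero
    let g' : 𝓢(Rn n, ℂ) := hgc'.toSchwartzMap (Complex.ofRealCLM.contDiff.comp hg)
    have h2 : ∀ x, g' x = (g x : ℂ) := fun x => rfl
    have h1 := hT g'
    rw [hTf.2 g' hgc'] at h1
    simp only [h2, Complex.norm_real, Real.norm_of_nonneg (hg0 _)] at h1
    simp only [mul_assoc, Complex.real_smul]
    rw [integral_const_mul]
    exact h1
  refine ⟨hgr, fun g => ?_⟩
  have hj : ∀ j : ℕ, 1 / ((j : ℝ) + 1) ≠ 0 := fun j => by positivity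
  have h1 : Tendsto (fun j : ℕ => T (truncate (1 / ((j : ℝ) + 1)) g)) atTop (𝓝 (T g)) :=
    (T.continuous.tendsto g).comp (tendsto_truncate g)
  refine tendsto_nhds_unique h1 ?_
  have h2 : ∀ j : ℕ, T (truncate (1 / ((j : ℝ) + 1)) g) =
      ∫ x, truncate (1 / ((j : ℝ) + 1)) g x * f x :=
    fun j => hTf.2 _ (hasCompactSupport_truncate (hj j) g)
  simp only [h2]
  refine tendsto_integral_of_dominated_convergence (fun x => ‖g x * f x‖)
    (fun j => ?_) ?_ (fun j => ?_) ?_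
  · exact (SchwartzMap.continuous _).aestronglyMeasurable.mul hTf.1.aestronglyMeasurable
  · exact (integrable_smul_of_growth hTf.1.aestronglyMeasurable hgr g).norm
  · refine Eventually.of_forall fun x => ?_
    rw [truncate_apply (hj j), mul_assoc, norm_mul]
    exact mul_le_of_le_one_left (norm_nonneg _) (norm_cutoff_le_one _)
  · refine Eventually.of_forall fun x => ?_
    have h3 : Tendsto (fun j : ℕ => ‖(1 / ((j : ℝ) + 1)) • x‖) atTop (𝓝 0) := by
      have := ((tendsto_one_div_add_atTop_nhds_zero_nat (𝕜 := ℝ)).smul_const x).norm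
      rwa [zero_smul, norm_zero] at this
    refine tendsto_const_nhds.congr' ?_
    filter_upwards [h3.eventually (gt_mem_nhds one_pos)] with j hjx
    rw [truncate_apply (hj j), cutoff_eq_one hjx.le, one_mul]

end

noncomputable section

variable {n N : ℕ}

/-! ### Mollification on the Fourier side -/

/-- The mollification `ρ_ε ∗ φ`. -/
abbrev mollify (ρ : Rn n → ℝ) (ε : ℝ) (φ : Rn n → ℂ) : Rn n → ℂ :=
  convolution (dilate ρ ε) φ (ContinuousLinearMap.lsmul ℝ ℝ) volume

theorem contDiff_dilate {ρ : Rn n → ℝ} (hρ : ContDiff ℝ ∞ ρ) (ε : ℝ) :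
    ContDiff ℝ ∞ (dilate ρ ε) :=
  contDiff_const.mul (hρ.comp (contDiff_const_smul ε⁻¹))

theorem hasCompactSupport_dilate {ρ : Rn n → ℝ} (hρ : HasCompactSupport ρ) {ε : ℝ} (hε : ε ≠ 0) :
    HasCompactSupport (dilate ρ ε) :=
  (hρ.comp_smul (inv_ne_zero hε)).mul_left

theorem contDiff_mollify {ρ : Rn n → ℝ} (hρ : ContDiff ℝ ∞ ρ) (hρc : HasCompactSupport ρ)
    {ε : ℝ} (hε : ε ≠ 0) {φ : Rn n → ℂ} (hφ : Integrable φ) : ContDiff ℝ ∞ (mollify ρ ε φ) :=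
  (hasCompactSupport_dilate hρc hε).contDiff_convolution_left _ (contDiff_dilate hρ ε)
    hφ.locallyIntegrable

theorem hasCompactSupport_of_support_subset_ball {φ : Rn n → ℂ} {x : Rn n} {R : ℝ}
    (h : Function.support φ ⊆ Metric.ball x R) : HasCompactSupport φ :=
  HasCompactSupport.of_support_subset_isCompact (isCompact_closedBall x R)
    (h.trans Metric.ball_subset_closedBall)

theorem oscInt_ofReal_dilate (ρ : Rn n → ℝ) {ε : ℝ} (hε : 0 < ε) (x : Rn n) :
    oscInt (fun ξ => (dilate ρ ε ξ : ℂ)) x = oscInt (fun ξ => (ρ ξ : ℂ)) (ε • x) := by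
  have h := Measure.integral_comp_smul (volume : Measure (Rn n))
    (fun s => Complex.exp (Complex.I * (inner ℝ (ε • x) s : ℝ)) * (ρ s : ℂ)) ε⁻¹
  rw [finrank_euclideanSpace_fin, inv_pow, inv_inv, abs_of_pos (by positivity)] at h
  have h2 : oscInt (fun ξ => (ρ ξ : ℂ)) (ε • x) = (ε ^ n)⁻¹ • ε ^ n •
      ∫ s, Complex.exp (Complex.I * (inner ℝ (ε • x) s : ℝ)) * (ρ s : ℂ) := by
    rw [inv_smul_smul₀ (pow_pos hε n).ne', oscInt]
  rw [h2, oscInt, ← h, ← integral_smul]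
  congr 1
  ext s
  have h1 : (inner ℝ (ε • x) (ε⁻¹ • s) : ℝ) = inner ℝ x s := by
    rw [real_inner_smul_left, real_inner_smul_right, mul_inv_cancel_left₀ hε.ne']
  rw [h1, dilate, Complex.real_smul]
  push_cast
  ring

theorem integrable_of_contDiff_hasCompactSupport {ρ : Rn n → ℝ} (hρ : ContDiff ℝ ∞ ρ)
    (hρc : HasCompactSupport ρ) : Integrable ρ :=
  hρ.continuous.integrable_of_hasCompactSupport hρc

/-- By the convolution theorem, mollifying φ multiplies its transform by a factor that, for a
mollifier ρ, is bounded by one and tends to one as ε → 0. -/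
theorem oscInt_mollify {ρ : Rn n → ℝ} (hρ : ContDiff ℝ ∞ ρ) (hρc : HasCompactSupport ρ)
    {ε : ℝ} (hε : 0 < ε) {φ : Rn n → ℂ} (hφ : Integrable φ) (x : Rn n) :
    oscInt (mollify ρ ε φ) x = oscInt (fun ξ => (ρ ξ : ℂ)) (ε • x) * oscInt φ x := by
  have hd : Integrable fun ξ => (dilate ρ ε ξ : ℂ) :=
    (integrable_of_contDiff_hasCompactSupport (contDiff_dilate hρ ε)
      (hasCompactSupport_dilate hρc hε.ne')).ofReal
  rw [← oscInt_ofReal_dilate ρ hε]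
  have h := integral_convolution (ContinuousLinearMap.mul ℂ ℂ) (integrable_exp_mul hd x)
    (integrable_exp_mul hφ x)
  rw [ContinuousLinearMap.mul_apply'] at h
  rw [oscInt, oscInt, oscInt, ← h]
  congr 1
  ext ξ
  rw [mollify, convolution_def, convolution_def, ← integral_const_mul]
  congr 1
  ext t
  have h1 : Complex.exp (Complex.I * (inner ℝ x ξ : ℝ)) =
      Complex.exp (Complex.I * (inner ℝ x t : ℝ)) *
        Complex.exp (Complex.I * (inner ℝ x (ξ - t) : ℝ)) := by
    rw [← Complex.exp_add, inner_sub_right]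
    push_cast
    ring_nf
  rw [h1, ContinuousLinearMap.mul_apply', ContinuousLinearMap.lsmul_apply, Complex.real_smul]
  ring

theorem support_mollify_subset {ρ : Rn n → ℝ} {r : ℝ}
    (hρ : Function.support ρ ⊆ Metric.ball 0 r) {ε : ℝ} (hε : 0 < ε) {φ : Rn n → ℂ} {z : Rn n}
    {R : ℝ} (hφ : Function.support φ ⊆ Metric.ball z R) :
    Function.support (mollify ρ ε φ) ⊆ Metric.ball z (ε * r + R) := by
  refine (support_convolution_subset _).trans ?_
  rintro _ ⟨a, ha, b, hb, rfl⟩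
  have h1 : ε⁻¹ • a ∈ Metric.ball (0 : Rn n) r := hρ (right_ne_zero_of_mul ha)
  have h2 := hφ hb
  rw [mem_ball_zero_iff, norm_smul, Real.norm_of_nonneg (by positivity),
    inv_mul_lt_iff₀ hε] at h1
  rw [Metric.mem_ball, dist_eq_norm] at h2 ⊢
  calc ‖a + b - z‖ = ‖a + (b - z)‖ := by rw [add_sub_assoc]
    _ ≤ ‖a‖ + ‖b - z‖ := norm_add_le _ _
    _ < _ := add_lt_add h1 h2

/-- Modulation and translation on the Fourier side. -/
def shiftMod (φ : Rn n → ℂ) (x ξ₀ ζ : Rn n) : ℂ :=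
  Complex.exp (Complex.I * (inner ℝ x (ζ - ξ₀) : ℝ)) * φ (ζ - ξ₀)

theorem integrable_shiftMod {φ : Rn n → ℂ} (hφ : Integrable φ) (x ξ₀ : Rn n) :
    Integrable (shiftMod φ x ξ₀) :=
  (integrable_exp_mul hφ x).comp_sub_right ξ₀

/-- This exhibits e^{-iξ₀·y} Φ(x - y) as the transform of a function supported in a ball about ξ₀,
so pairing it with f tests F f away from the origin. -/
theorem oscInt_shiftMod (φ : Rn n → ℂ) (x ξ₀ y : Rn n) :
    oscInt (shiftMod φ x ξ₀) (-y) =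
      Complex.exp (Complex.I * (inner ℝ (-ξ₀) y : ℝ)) * oscInt φ (x - y) := by
  rw [oscInt, oscInt, ← integral_const_mul, ← integral_add_right_eq_self _ ξ₀]
  congr 1
  ext η
  rw [shiftMod, add_sub_cancel_right, ← mul_assoc, ← mul_assoc, ← Complex.exp_add,
    ← Complex.exp_add]
  congr 2
  rw [inner_add_right, inner_sub_left, inner_neg_left, inner_neg_left, inner_neg_left,
    real_inner_comm ξ₀ y]
  push_cast
  ring

theorem support_shiftMod_subset {φ : Rn n → ℂ} {R : ℝ}
    (hφ : Function.support φ ⊆ Metric.ball 0 R) (x ξ₀ : Rn n) :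
    Function.support (shiftMod φ x ξ₀) ⊆ Metric.ball ξ₀ R := by
  intro ζ hζ
  have h := hφ (right_ne_zero_of_mul hζ)
  rwa [mem_ball_zero_iff, ← dist_eq_norm] at h

/-- `y ↦ m(ε y) Φ(x - y) f(y)` has Fourier transform supported in the ball of radius `3R`, if
`f` and `Φ` have Fourier transforms supported in the ball of radius `R`. -/
theorem integral_exp_mul_oscInt_mul_eq_zero {T : 𝓢'(Rn n, ℂ)} {R : ℝ}
    (hT : Distribution.dsupport (fourierDist T) ⊆ Metric.ball 0 R) {f : Rn n → ℂ}
    (hTf : ∀ g : 𝓢(Rn n, ℂ), T g = ∫ x, g x * f x) {φ : Rn n → ℂ} (hφ : Integrable φ)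
    (hφR : Function.support φ ⊆ Metric.ball 0 R) {ρ : Rn n → ℝ} (hρ : ContDiff ℝ ∞ ρ)
    (hρ1 : Function.support ρ ⊆ Metric.ball 0 1) {ε : ℝ} (hε : 0 < ε) (hεR : ε ≤ R)
    (x ξ : Rn n) (hξ : 3 * R ≤ ‖ξ‖) :
    ∫ y, Complex.exp (Complex.I * (inner ℝ ξ y : ℝ)) *
      (oscInt (fun ξ => (ρ ξ : ℂ)) (-(ε • y)) * oscInt φ (x - y) * f y) = 0 := by
  have hρc : HasCompactSupport ρ :=
    HasCompactSupport.of_support_subset_isCompact (isCompact_closedBall 0 1)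
    (hρ1.trans Metric.ball_subset_closedBall)
  have hv := integrable_shiftMod hφ x (-ξ)
  have hsupp := support_mollify_subset hρ1 hε (support_shiftMod_subset hφR x (-ξ))
  let u : 𝓢(Rn n, ℂ) := (hasCompactSupport_of_support_subset_ball hsupp).toSchwartzMap
    (contDiff_mollify hρ hρc hε.ne' hv)
  have hu : ⇑u = mollify ρ ε (shiftMod φ x (-ξ)) := rfl
  have h0 : T (fourierSchwartz n u) = 0 := by
    refine apply_eq_zero_of_tsupport_subset (T := fourierDist T) (u := u) fun z hz hzT => ?_
    -- The radius 3R leaves room for R from φ, R from f and ε ≤ R from the mollification: u lives in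
    -- the ball of radius ε + R ≤ 2R about -ξ, hence outside the open ball of radius R.
    have hsub : tsupport u ⊆ {z | R ≤ ‖z‖} := by
      refine closure_minimal (fun z hz => ?_) (isClosed_le continuous_const continuous_norm)
      have h1 := hsupp hz
      rw [Metric.mem_ball, dist_eq_norm, sub_neg_eq_add] at h1
      have h2 : ‖ξ‖ ≤ ‖z + ξ‖ + ‖z‖ := by
        calc ‖ξ‖ = ‖(z + ξ) - z‖ := by rw [add_sub_cancel_left]
          _ ≤ _ := norm_sub_le _ _
      rw [Set.mem_ofPred_eq]
      linarith
    have h3 := hT hzT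
    rw [mem_ball_zero_iff] at h3
    exact absurd (hsub hz) (not_le.2 h3)
  have hc := fourierFactor_ne_zero n
  rw [hTf] at h0
  have h1 : ∀ y, fourierSchwartz n u y * f y = fourierFactor n *
      (Complex.exp (Complex.I * (inner ℝ ξ y : ℝ)) *
      (oscInt (fun ξ => (ρ ξ : ℂ)) (-(ε • y)) * oscInt φ (x - y) * f y)) := by
    intro y
    rw [fourierSchwartz_eq_oscInt, hu, oscInt_mollify hρ hρc hε hv, oscInt_shiftMod, neg_neg,
      smul_neg]
    ring
  simp only [h1] at h0
  rw [integral_const_mul] at h0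
  exact (mul_eq_zero.1 h0).resolve_left hc

/-! ### Band-limited vector functions -/

theorem IsBandlimited.exists_growth {R : ℝ} {f : Rn n → CN N} (hf : IsBandlimited R f)
    (i : Fin N) : ∃ (T : 𝓢'(Rn n, ℂ)) (C : ℝ) (L : ℕ),
      IsRepresentedBy T (fun x => f x i) ∧
      Distribution.dsupport (fourierDist T) ⊆ Metric.ball 0 R ∧ 0 ≤ C ∧
      (∀ᵐ x, ‖f x i‖ ≤ C * (1 + ‖x‖) ^ L) ∧ ∀ g : 𝓢(Rn n, ℂ), T g = ∫ x, g x * f x i := by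
  obtain ⟨T, hTf, hT⟩ := hf i
  obtain ⟨C, L, hC, h⟩ := exists_norm_apply_le_of_dsupport_subset hT
  obtain ⟨h1, h2⟩ := hTf.growth h
  exact ⟨T, C, L, hTf, hT, hC, h1, h2⟩

theorem aestronglyMeasurable_of_apply {f : Rn n → CN N}
    (h : ∀ i, AEStronglyMeasurable (fun x => f x i) volume) : AEStronglyMeasurable f volume := by
  have h1 : AEMeasurable (fun x => WithLp.ofLp (f x)) volume :=
    aemeasurable_pi_lambda _ fun i => (h i).aemeasurable
  exact ((MeasurableEquiv.toLp 2 (Fin N → ℂ)).measurable.comp_aemeasurable h1).aestronglyMeasurable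

theorem IsBandlimited.aestronglyMeasurable {R : ℝ} {f : Rn n → CN N} (hf : IsBandlimited R f) :
    AEStronglyMeasurable f volume := by
  refine aestronglyMeasurable_of_apply fun i => ?_
  obtain ⟨T, hT, -⟩ := hf i
  exact hT.1.aestronglyMeasurable

theorem IsBandlimited.exists_norm_le {R : ℝ} {f : Rn n → CN N} (hf : IsBandlimited R f) :
    ∃ (C : ℝ) (L : ℕ), ∀ᵐ x, ‖f x‖ ≤ C * (1 + ‖x‖) ^ L := by
  choose T C L _ _ hC hb _ using hf.exists_growth
  refine ⟨∑ i, C i, Finset.univ.sup L, ?_⟩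
  filter_upwards [ae_all_iff.2 hb] with x hx
  have h1 : (1 : ℝ) ≤ 1 + ‖x‖ := by linarith [norm_nonneg x]
  calc ‖f x‖ = ‖∑ i, EuclideanSpace.single i (f x i)‖ := by
        congr 1
        ext j
        simp [Finset.sum_apply, Pi.single_apply]
    _ ≤ ∑ i, ‖f x i‖ := (norm_sum_le _ _).trans (le_of_eq (by simp))
    _ ≤ ∑ i, C i * (1 + ‖x‖) ^ Finset.univ.sup L := by
        refine Finset.sum_le_sum fun i _ => (hx i).trans ?_
        have := hC i
        gcongr
        exact Finset.le_sup (Finset.mem_univ i)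
    _ = _ := by rw [Finset.sum_mul]

theorem integral_euclidean_apply {g : Rn n → CN N} (hg : Integrable g) (i : Fin N) :
    (∫ y, g y) i = ∫ y, g y i :=
  ((EuclideanSpace.proj (𝕜 := ℂ) i).integral_comp_comm hg).symm

theorem norm_oscInt_ofReal_le_one {ρ : Rn n → ℝ} (hρ0 : ∀ x, 0 ≤ ρ x) (hρ1 : ∫ x, ρ x = 1)
    (x : Rn n) : ‖oscInt (fun ξ => (ρ ξ : ℂ)) x‖ ≤ 1 := by
  refine (norm_oscInt_le _ _).trans (le_of_eq ?_)
  simp only [Complex.norm_real, Real.norm_of_nonneg (hρ0 _)]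
  exact hρ1

theorem tendsto_oscInt_ofReal {ρ : Rn n → ℝ} (hρ : Integrable ρ) (hρ1 : ∫ x, ρ x = 1)
    (x : Rn n) : Tendsto (fun ε : ℝ => oscInt (fun ξ => (ρ ξ : ℂ)) (ε • x)) (𝓝 0) (𝓝 1) := by
  have h0 : oscInt (fun ξ => (ρ ξ : ℂ)) 0 = 1 := by
    simp only [oscInt, inner_zero_left, Complex.ofReal_zero, mul_zero, Complex.exp_zero, one_mul]
    rw [integral_complex_ofReal, hρ1, Complex.ofReal_one]
  have h1 : Continuous fun ε : ℝ => oscInt (fun ξ => (ρ ξ : ℂ)) (ε • x) :=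
    (continuous_oscInt hρ.ofReal).comp (by fun_prop)
  have h2 := h1.tendsto 0
  rwa [zero_smul, h0] at h2

/-- Nikolskii's inequality for `y ↦ Φ(x - y) A f(y)`, where `f` and the Fourier transform `Φ` of
`φ` are band-limited; no integrability is assumed. -/
theorem IsBandlimited.lintegral_mul_enorm_rpow_le {R : ℝ} (hR : 0 < R) {f : Rn n → CN N}
    (hf : IsBandlimited R f) {φ : Rn n → ℂ} (hφ : Integrable φ)
    (hφR : Function.support φ ⊆ Metric.ball 0 R) (A : CN N →L[ℂ] CN N) (x : Rn n)
    {p : ℝ} (hp0 : 0 < p) (hp1 : p ≤ 1) :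
    (∫⁻ y, ‖oscInt φ (x - y)‖ₑ * ‖A (f y)‖ₑ) ^ p ≤
      volume (Metric.ball (0 : Rn n) (3 * R)) ^ (1 - p) *
        ∫⁻ y, (‖oscInt φ (x - y)‖ₑ * ‖A (f y)‖ₑ) ^ p := by
  set X := volume (Metric.ball (0 : Rn n) (3 * R)) ^ (1 - p) *
        ∫⁻ y, (‖oscInt φ (x - y)‖ₑ * ‖A (f y)‖ₑ) ^ p with hX
  let b : ContDiffBump (0 : Rn n) := ⟨1 / 4, 1 / 2, by norm_num, by norm_num⟩
  let ρ : Rn n → ℝ := b.normed volume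
  have hρ : ContDiff ℝ ∞ ρ := b.contDiff_normed
  have hρc : HasCompactSupport ρ := b.hasCompactSupport_normed
  have hρ0 : ∀ x, 0 ≤ ρ x := fun x => b.nonneg_normed x
  have hρ1 : ∫ x, ρ x = 1 := b.integral_normed
  have hρs : Function.support ρ ⊆ Metric.ball 0 1 := by
    rw [b.support_normed_eq]
    exact Metric.ball_subset_ball (by norm_num)
  set m : ℝ → Rn n → ℂ := fun ε y => oscInt (fun ξ => (ρ ξ : ℂ)) (-(ε • y)) with hm
  have hm1 : ∀ ε y, ‖m ε y‖ ≤ 1 := fun ε y => norm_oscInt_ofReal_le_one hρ0 hρ1 _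
  have hfm := hf.aestronglyMeasurable
  obtain ⟨C, L, hC⟩ := hf.exists_norm_le
  -- Up to a constant, m ε is the Fourier transform of a test function, hence Schwartz, and it beats
  -- the polynomial growth of f.
  have hint : ∀ ε : ℝ, 0 < ε → Integrable fun y => (m ε y * oscInt φ (x - y)) • f y := by
    intro ε hε
    let g : 𝓢(Rn n, ℂ) := ((hasCompactSupport_dilate hρc hε.ne').comp_left
      (g := Complex.ofReal) Complex.ofReal_zero).toSchwartzMap
      (Complex.ofRealCLM.contDiff.comp (contDiff_dilate hρ ε))
    have hg : ⇑g = fun ξ => (dilate ρ ε ξ : ℂ) := rfl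
    have hc := fourierFactor_ne_zero n
    have h1 : ∀ᵐ y, ‖oscInt φ (x - y) • f y‖ ≤ ((∫ ξ, ‖φ ξ‖) * C) * (1 + ‖y‖) ^ L := by
      filter_upwards [hC] with y hy
      rw [norm_smul, mul_assoc]
      exact mul_le_mul (norm_oscInt_le _ _) hy (norm_nonneg _)
        (integral_nonneg fun _ => norm_nonneg _)
    have h2 := (integrable_smul_of_growth (((continuous_oscInt hφ).comp
      (continuous_const.sub continuous_id)).aestronglyMeasurable.smul hfm) h1
      (fourierSchwartz n g)).smul (fourierFactor n)⁻¹
    refine h2.congr (Eventually.of_forall fun y => ?_)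
    simp only [Pi.smul_apply', Pi.smul_apply, Function.comp, smul_smul]
    rw [fourierSchwartz_eq_oscInt, hg, oscInt_ofReal_dilate ρ hε, smul_neg, ← mul_assoc,
      inv_mul_cancel_left₀ hc]
    rfl
  have hG : ∀ ε : ℝ, 0 < ε → ε ≤ R →
      (∫⁻ y, ‖(m ε y * oscInt φ (x - y)) • A (f y)‖ₑ) ^ p ≤ X := by
    intro ε hε hεR
    have hi : Integrable fun y => (m ε y * oscInt φ (x - y)) • A (f y) := by
      refine (A.integrable_comp (hint ε hε)).congr (Eventually.of_forall fun y => ?_)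
      simp only [map_smul]
    refine (lintegral_enorm_rpow_le_of_oscillatory_eq_zero hi (S := 3 * R) (fun ξ hξ => ?_)
      hp0 hp1).trans ?_
    · have h1 : ∫ y, Complex.exp (Complex.I * (inner ℝ ξ y : ℝ)) •
          ((m ε y * oscInt φ (x - y)) • f y) = 0 := by
        ext i
        rw [integral_euclidean_apply (integrable_exp_smul (hint ε hε) ξ)]
        obtain ⟨T, _, _, _, hT, _, _, hTf⟩ := hf.exists_growth i
        exact integral_exp_mul_oscInt_mul_eq_zero hT hTf hφ hφR hρ hρs hε hεR x ξ hξ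
      have h2 := A.integral_comp_comm (integrable_exp_smul (hint ε hε) ξ)
      rw [h1, map_zero] at h2
      simpa only [map_smul] using h2
    · refine mul_le_mul_right (lintegral_mono fun y => ENNReal.rpow_le_rpow ?_ hp0.le) _
      rw [enorm_smul]
      gcongr
      rw [enorm_mul]
      refine mul_le_of_le_one_left zero_le ?_
      rw [← ofReal_norm]
      exact ENNReal.ofReal_le_one.2 (hm1 ε y)
  set ε : ℕ → ℝ := fun k => R * (1 / ((k : ℝ) + 1)) with hεdef
  have hε0 : ∀ k, 0 < ε k := fun k => by positivity
  have hεR : ∀ k, ε k ≤ R := fun k => by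
    refine mul_le_of_le_one_right hR.le ?_
    rw [div_le_one (by positivity)]
    have : (0 : ℝ) ≤ k := by positivity
    linarith
  have hεlim : Tendsto ε atTop (𝓝 0) := by
    have := (tendsto_one_div_add_atTop_nhds_zero_nat (𝕜 := ℝ)).const_mul R
    rwa [mul_zero] at this
  -- Fatou's lemma as ε → 0. The bound X is independent of ε, and nothing is to prove if it is
  -- infinite.
  have hle : ∫⁻ y, ‖oscInt φ (x - y)‖ₑ * ‖A (f y)‖ₑ ≤ X ^ (1 / p) := by
    calc ∫⁻ y, ‖oscInt φ (x - y)‖ₑ * ‖A (f y)‖ₑ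
        = ∫⁻ y, liminf (fun k => ‖(m (ε k) y * oscInt φ (x - y)) • A (f y)‖ₑ) atTop := by
          congr 1
          ext y
          have h1 : Tendsto (fun k => m (ε k) y) atTop (𝓝 1) := by
            have := (tendsto_oscInt_ofReal
              (integrable_of_contDiff_hasCompactSupport hρ hρc) hρ1 (-y)).comp hεlim
            refine this.congr fun k => ?_
            rw [hm, Function.comp, smul_neg]
          have h2 := ((h1.mul_const (oscInt φ (x - y))).smul_const (A (f y))).enorm
          rw [one_mul, enorm_smul] at h2
          exact h2.liminf_eq.symm
      _ ≤ liminf (fun k => ∫⁻ y, ‖(m (ε k) y * oscInt φ (x - y)) • A (f y)‖ₑ) atTop := by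
          refine lintegral_liminf_le' fun k => ?_
          have hi := (A.integrable_comp (hint (ε k) (hε0 k))).aestronglyMeasurable.enorm
          simpa only [map_smul] using hi
      _ ≤ liminf (fun _ : ℕ => X ^ (1 / p)) atTop := by
          refine liminf_le_liminf (Eventually.of_forall fun k => ?_)
          rw [one_div, ENNReal.le_rpow_inv_iff hp0]
          exact hG (ε k) (hε0 k) (hεR k)
      _ = _ := liminf_const _
  rwa [one_div, ENNReal.le_rpow_inv_iff hp0] at hle

end

noncomputable section

variable {n N : ℕ}

/-! ### Powers of positive definite matrices -/

theorem matPow_neg_mul_matPow {A : Matrix (Fin N) (Fin N) ℂ} (hA : A.PosDef) (s : ℝ) :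
    matPow A (-s) * matPow A s = 1 := by
  have hsa : IsSelfAdjoint A := hA.isHermitian
  have hcont : ∀ f : ℝ → ℝ, ContinuousOn f (spectrum ℝ A) :=
    fun f => A.finite_real_spectrum.continuousOn f
  rw [matPow, matPow, ← cfc_mul _ _ _ (hcont _) (hcont _)]
  have h : cfc (fun x : ℝ => x ^ (-s) * x ^ s) A = cfc (fun _ : ℝ => (1 : ℝ)) A := by
    refine cfc_congr fun x hx => ?_
    obtain ⟨i, rfl⟩ := hA.isHermitian.spectrum_real_eq_range_eigenvalues ▸ hx
    have hpos := hA.eigenvalues_pos i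
    rw [← Real.rpow_add hpos, neg_add_cancel, Real.rpow_zero]
  rw [h, cfc_const_one ℝ A]

/-- For a fixed matrix the diagonalising unitary is fixed, so pointwise convergence at the
eigenvalues suffices. -/
theorem tendsto_cfc_apply {A : Matrix (Fin N) (Fin N) ℂ} (hA : A.IsHermitian) {g : ℕ → ℝ → ℝ}
    {f : ℝ → ℝ} (h : ∀ x, Tendsto (fun k => g k x) atTop (𝓝 (f x))) (i j : Fin N) :
    Tendsto (fun k => cfc (g k) A i j) atTop (𝓝 (cfc f A i j)) := by
  simp only [hA.cfc_eq, Matrix.IsHermitian.cfc, Unitary.conjStarAlgAut_apply]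
  have hc : Continuous fun d : Fin N → ℂ => ((hA.eigenvectorUnitary : Matrix (Fin N) (Fin N) ℂ) *
      Matrix.diagonal d * (star hA.eigenvectorUnitary : Matrix (Fin N) (Fin N) ℂ)) i j :=
    ((continuous_const.matrix_mul continuous_id.matrix_diagonal).matrix_mul
      continuous_const).matrix_elem i j
  have hd : Tendsto (fun k => (RCLike.ofReal ∘ g k ∘ hA.eigenvalues : Fin N → ℂ)) atTop
      (𝓝 (RCLike.ofReal ∘ f ∘ hA.eigenvalues)) :=
    tendsto_pi_nhds.2 fun l => (RCLike.continuous_ofReal.tendsto _).comp (h _)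
  exact (hc.tendsto _).comp hd

/-- Weierstrass approximation on [-k, k] within 1/(k + 1); each x lies in all but finitely many of
these intervals. -/
theorem exists_polynomial_tendsto {f : ℝ → ℝ} (hf : Continuous f) :
    ∃ P : ℕ → Polynomial ℝ, ∀ x, Tendsto (fun k => (P k).eval x) atTop (𝓝 (f x)) := by
  have h : ∀ k : ℕ, ∃ P : Polynomial ℝ, ∀ x ∈ Set.Icc (-(k : ℝ)) k,
      |P.eval x - f x| < 1 / ((k : ℝ) + 1) := fun k =>
    exists_polynomial_near_of_continuousOn _ _ f hf.continuousOn _ (by positivity)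
  choose P hP using h
  refine ⟨P, fun x => ?_⟩
  rw [tendsto_iff_dist_tendsto_zero]
  refine squeeze_zero' (Eventually.of_forall fun _ => dist_nonneg) ?_
    (tendsto_one_div_add_atTop_nhds_zero_nat (𝕜 := ℝ))
  filter_upwards [eventually_ge_atTop ⌈|x|⌉₊] with k hk
  rw [Real.dist_eq]
  exact (hP k x (abs_le.1 (Nat.ceil_le.1 hk))).le

section Measurability

variable {α : Type*} [MeasurableSpace α] {μ : Measure α} {W : α → Matrix (Fin N) (Fin N) ℂ}

theorem aestronglyMeasurable_matrix_pow (hW : ∀ i j, AEStronglyMeasurable (fun x => W x i j) μ)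
    (k : ℕ) (i j : Fin N) : AEStronglyMeasurable (fun x => (W x ^ k) i j) μ := by
  induction k generalizing i j with
  | zero => simp only [pow_zero]; exact aestronglyMeasurable_const
  | succ k ih =>
    simp only [pow_succ, Matrix.mul_apply]
    exact Finset.aestronglyMeasurable_fun_sum _ fun l _ => (ih i l).mul (hW l j)

theorem aestronglyMeasurable_matrix_aeval (hW : ∀ i j, AEStronglyMeasurable (fun x => W x i j) μ)
    (P : Polynomial ℝ) (i j : Fin N) :
    AEStronglyMeasurable (fun x => (Polynomial.aeval (W x) P) i j) μ := by
  simp only [Polynomial.aeval_eq_sum_range, Matrix.sum_apply, Matrix.smul_apply]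
  exact Finset.aestronglyMeasurable_fun_sum _ fun l _ =>
    (aestronglyMeasurable_matrix_pow hW l i j).const_smul (P.coeff l)

/-- The power is a pointwise limit of polynomials in W, so no measurable choice of eigenvectors is
needed. Positivity of s makes x ↦ x^s continuous on the whole line. -/
theorem aestronglyMeasurable_matPow (hW : ∀ i j, AEStronglyMeasurable (fun x => W x i j) μ)
    (hpos : ∀ᵐ x ∂μ, (W x).PosDef) {s : ℝ} (hs : 0 < s) (i j : Fin N) :
    AEStronglyMeasurable (fun x => matPow (W x) s i j) μ := by
  obtain ⟨P, hP⟩ := exists_polynomial_tendsto (Real.continuous_rpow_const hs.le)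
  refine aestronglyMeasurable_of_tendsto_ae atTop
    (fun k => aestronglyMeasurable_matrix_aeval hW (P k) i j) ?_
  filter_upwards [hpos] with x hx
  have h := tendsto_cfc_apply hx.isHermitian hP i j
  refine h.congr fun k => ?_
  have hsa : IsSelfAdjoint (W x) := hx.isHermitian
  rw [cfc_polynomial (P k) (W x) hsa]

theorem aestronglyMeasurable_toOp {B : α → Matrix (Fin N) (Fin N) ℂ}
    (hB : ∀ i j, AEStronglyMeasurable (fun x => B x i j) μ) :
    AEStronglyMeasurable (fun x => toOp (B x)) μ := by
  have h : ∀ x, toOp (B x) = ∑ i, ∑ j, B x i j • toOp (Matrix.single i j (1 : ℂ)) := by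
    intro x
    conv_lhs => rw [Matrix.matrix_eq_sum_single (B x)]
    simp only [toOp, map_sum, ← map_smul, Matrix.smul_single, smul_eq_mul, mul_one]
  simp only [h]
  exact Finset.aestronglyMeasurable_fun_sum _ fun i _ =>
    Finset.aestronglyMeasurable_fun_sum _ fun j _ => (hB i j).smul_const _

end Measurability

/-! ### Weights -/

variable {W : Rn n → Matrix (Fin N) (Fin N) ℂ} {p : ℝ}

theorem IsMatrixWeight.aestronglyMeasurable_toOp (hW : IsMatrixWeight W) (hp : 0 < p) :
    AEStronglyMeasurable (fun x => toOp (matPow (W x) (1 / p))) volume :=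
  MatrixWeight.aestronglyMeasurable_toOp (aestronglyMeasurable_matPow
    (fun i j => (hW.locallyIntegrable i j).aestronglyMeasurable) hW.posDef (by positivity))

theorem IsMatrixWeight.aemeasurable_scalarWeight (hW : IsMatrixWeight W) (hp : 0 < p)
    (v : CN N) : AEMeasurable (scalarWeight p W v) volume :=
  ((ContinuousLinearMap.apply ℂ (CN N) v).continuous.comp_aestronglyMeasurable
    (hW.aestronglyMeasurable_toOp hp)).enorm.pow_const p

theorem scalarWeight_ne_top (hp : 0 < p) (v : CN N) (x : Rn n) : scalarWeight p W v x ≠ ⊤ :=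
  ENNReal.rpow_ne_top_of_nonneg hp.le enorm_ne_top

theorem toOp_matPow_neg_apply {A : Matrix (Fin N) (Fin N) ℂ} (hA : A.PosDef) (s : ℝ) (v : CN N) :
    toOp (matPow A (-s)) (toOp (matPow A s) v) = v := by
  have h : toOp (matPow A (-s)) * toOp (matPow A s) = 1 := by
    rw [← map_mul, matPow_neg_mul_matPow hA, map_one]
  exact congrArg (fun L : CN N →L[ℂ] CN N => L v) h

theorem cube_eq_preimage (z : Rn n) (r : ℝ) :
    cube z r = (@WithLp.ofLp 2 (Fin n → ℝ)) ⁻¹'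
      (Set.univ.pi fun i => Set.Ico (z i - r / 2) (z i + r / 2)) := by
  ext x
  simp [cube]

theorem measurableSet_cube (z : Rn n) (r : ℝ) : MeasurableSet (cube z r) := by
  rw [cube_eq_preimage]
  exact (MeasurableSet.univ_pi fun i => measurableSet_Ico).preimage
    (PiLp.volume_preserving_ofLp (Fin n)).measurable

theorem volume_cube (z : Rn n) (r : ℝ) : volume (cube z r) = ENNReal.ofReal r ^ n := by
  rw [cube_eq_preimage, (PiLp.volume_preserving_ofLp (Fin n)).measure_preimage
    (MeasurableSet.univ_pi fun i => measurableSet_Ico).nullMeasurableSet, Real.volume_pi_Ico]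
  have : ∀ i, z i + r / 2 - (z i - r / 2) = r := fun i => by ring
  simp [this]

/-- The scalar weights `w_v` satisfy Muckenhoupt's `A₁` condition, with an exceptional set that
does not depend on `v`. -/
theorem ae_setLIntegral_scalarWeight_le (hW : IsMatrixWeight W) (hp : 0 < p) {A : ℝ≥0∞}
    (hA : apConst p W = A) {r : ℝ} (hr : 0 < r) (z : Rn n) :
    ∀ᵐ y, y ∈ cube z r → ∀ v : CN N, ∫⁻ t in cube z r, scalarWeight p W v t ≤
      A * ENNReal.ofReal r ^ n * scalarWeight p W v y := by
  have h1 := ENNReal.ae_le_essSup (μ := volume.restrict (cube z r))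
    (fun y => (volume (cube z r))⁻¹ *
        ∫⁻ t in cube z r, ‖toOp (matPow (W t) (1 / p) * matPow (W y) (-(1 / p)))‖ₑ ^ p)
  rw [ae_restrict_iff' (measurableSet_cube z r)] at h1
  filter_upwards [h1, hW.posDef] with y hy hpos hyc v
  have h2 : (volume (cube z r))⁻¹ *
      ∫⁻ t in cube z r, ‖toOp (matPow (W t) (1 / p) * matPow (W y) (-(1 / p)))‖ₑ ^ p ≤ A := by
    refine (hy hyc).trans (le_trans ?_ hA.le)
    exact le_iSup_of_le z (le_iSup_of_le r (le_iSup_of_le hr le_rfl))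
  rw [volume_cube, ← ENNReal.div_eq_inv_mul, ENNReal.div_le_iff
    (pow_ne_zero _ (ENNReal.ofReal_pos.2 hr).ne') (ENNReal.pow_ne_top ENNReal.ofReal_ne_top)] at h2
  refine le_trans ?_ (mul_le_mul_left h2 (scalarWeight p W v y))
  rw [← lintegral_mul_const' _ _ (scalarWeight_ne_top hp v y)]
  refine lintegral_mono fun t => ?_
  rw [scalarWeight, scalarWeight, ← ENNReal.mul_rpow_of_nonneg _ _ hp.le]
  refine ENNReal.rpow_le_rpow ?_ hp.le
  have h3 : toOp (matPow (W t) (1 / p)) v =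
      toOp (matPow (W t) (1 / p) * matPow (W y) (-(1 / p)))
        (toOp (matPow (W y) (1 / p)) v) := by
    have h4 : toOp (matPow (W t) (1 / p) * matPow (W y) (-(1 / p))) =
        toOp (matPow (W t) (1 / p)) * toOp (matPow (W y) (-(1 / p))) := map_mul _ _ _
    rw [h4]
    exact congrArg _ (toOp_matPow_neg_apply hpos (1 / p) v).symm
  rw [h3]
  exact ContinuousLinearMap.le_opENorm _ _

/-- The A₁ bound at a single good point of the cube already gives finiteness. -/
theorem setLIntegral_scalarWeight_ne_top (hW : IsMatrixWeight W) (hp : 0 < p) {A : ℝ≥0}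
    (hA : apConst p W = A) {r : ℝ} (hr : 0 < r) (z : Rn n) (v : CN N) :
    ∫⁻ t in cube z r, scalarWeight p W v t ≠ ⊤ := by
  have hvol : volume (cube z r) ≠ 0 := by
    rw [volume_cube]
    exact pow_ne_zero _ (ENNReal.ofReal_pos.2 hr).ne'
  obtain ⟨y, hyc, hy⟩ := ((frequently_ae_mem_iff.2 hvol).and_eventually
    (ae_setLIntegral_scalarWeight_le hW hp hA hr z)).exists
  exact ne_top_of_le_ne_top (ENNReal.mul_ne_top (ENNReal.mul_ne_top ENNReal.coe_ne_top
    (ENNReal.pow_ne_top ENNReal.ofReal_ne_top)) (scalarWeight_ne_top hp v y)) (hy hyc v)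

theorem setLIntegral_scalarWeight_ne_zero (hW : IsMatrixWeight W) (hp : 0 < p)
    {r : ℝ} (hr : 0 < r) (z : Rn n) {v : CN N} (hv : v ≠ 0) :
    ∫⁻ t in cube z r, scalarWeight p W v t ≠ 0 := by
  intro h0
  rw [lintegral_eq_zero_iff' (hW.aemeasurable_scalarWeight hp v).restrict] at h0
  have hvol : volume (cube z r) ≠ 0 := by
    rw [volume_cube]
    exact pow_ne_zero _ (ENNReal.ofReal_pos.2 hr).ne'
  obtain ⟨y, hyc, hy, hpos⟩ := ((frequently_ae_mem_iff.2 hvol).and_eventually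
    (((ae_restrict_iff' (measurableSet_cube z r)).1 h0).and hW.posDef)).exists
  have h1 := hy hyc
  rw [Pi.zero_apply, scalarWeight, ENNReal.rpow_eq_zero_iff_of_pos hp, enorm_eq_zero] at h1
  have h2 := toOp_matPow_neg_apply hpos (1 / p) v
  rw [h1, map_zero] at h2
  exact hv h2.symm

/-- The doubling exponent of an `A_p` weight is at least `1/2`. -/
theorem IsDoublingExponent.half_le {β : ℝ} (hβ : IsDoublingExponent p W β)
    (hW : IsMatrixWeight W) (hp : 0 < p) {A : ℝ≥0} (hA : apConst p W = A) (hn : 0 < n)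
    (hN : 0 < N) : 1 / 2 ≤ β := by
  obtain ⟨v, hv⟩ : ∃ v : CN N, v ≠ 0 :=
    ⟨EuclideanSpace.single ⟨0, hN⟩ 1, by simp⟩
  set w : Set (Rn n) → ℝ≥0∞ := fun s => ∫⁻ t in s, scalarWeight p W v t with hw
  set D := ENNReal.ofReal (2 ^ β) with hD
  have hdbl : ∀ (z : Rn n) (r : ℝ), 0 < r → w (cube z (2 * r)) ≤ D * w (cube z r) := hβ.1 v
  let e : ℝ → Rn n := fun a => WithLp.toLp 2 fun _ => a
  have he : ∀ a i, e a i = a := fun a i => rfl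
  -- For a = ±1/4 these cubes of side 1/2 sit in opposite corners of Q(0,1), and doubling either one
  -- twice covers Q(0,1).
  have hcorner : ∀ a : ℝ, |a| ≤ 1 / 4 → w (cube 0 1) ≤ D * (D * w (cube (e a) (1 / 2))) := by
    intro a ha
    rw [abs_le] at ha
    calc w (cube 0 1) ≤ w (cube (e a) (2 * 1)) := by
          refine lintegral_mono_set fun x hx i => ?_
          have := hx i
          simp only [PiLp.zero_apply] at this
          rw [he]
          constructor <;> linarith
      _ ≤ D * w (cube (e a) 1) := hdbl _ _ one_pos
      _ = D * w (cube (e a) (2 * (1 / 2))) := by norm_num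
      _ ≤ _ := by
          gcongr
          exact hdbl _ _ (by norm_num)
  have hdisj : Disjoint (cube (e (-(1 / 4))) (1 / 2)) (cube (e (1 / 4)) (1 / 2)) := by
    rw [Set.disjoint_left]
    intro x hx hx'
    have h1 := (hx ⟨0, hn⟩).2
    have h2 := (hx' ⟨0, hn⟩).1
    simp only [he] at h1 h2
    linarith
  have hsub : cube (e (-(1 / 4))) (1 / 2) ∪ cube (e (1 / 4)) (1 / 2) ⊆ cube (0 : Rn n) 1 := by
    rintro x (hx | hx) i
    all_goals
      have := hx i
      simp only [he] at this
      simp only [PiLp.zero_apply]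
      constructor <;> linarith
  have hsum : w (cube (e (-(1 / 4))) (1 / 2)) + w (cube (e (1 / 4)) (1 / 2)) ≤ w (cube 0 1) := by
    rw [hw]
    dsimp only
    rw [← lintegral_union (measurableSet_cube _ _) hdisj]
    exact lintegral_mono_set hsub
  -- Each of the two disjoint corner cubes carries at least the fraction D⁻² of the mass, so 2 ≤ D²
  -- = 2^{2β}.
  have h2 : 2 * w (cube 0 1) ≤ D * D * w (cube 0 1) := by
    calc 2 * w (cube 0 1) = w (cube 0 1) + w (cube 0 1) := two_mul _
      _ ≤ D * (D * w (cube (e (-(1 / 4))) (1 / 2))) + D * (D * w (cube (e (1 / 4)) (1 / 2))) :=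
          add_le_add (hcorner _ (by rw [abs_neg, abs_of_pos (by norm_num)]))
            (hcorner _ (by rw [abs_of_pos (by norm_num)]))
      _ = D * D * (w (cube (e (-(1 / 4))) (1 / 2)) + w (cube (e (1 / 4)) (1 / 2))) := by ring
      _ ≤ _ := by gcongr
  have h3 : (2 : ℝ≥0∞) ≤ D * D :=
    (ENNReal.mul_le_mul_iff_left (setLIntegral_scalarWeight_ne_zero hW hp one_pos 0 hv)
      (setLIntegral_scalarWeight_ne_top hW hp hA one_pos 0 v)).1 h2
  rw [hD, ← ENNReal.ofReal_mul (by positivity), ← Real.rpow_add two_pos,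
    ← ENNReal.ofReal_ofNat 2, ENNReal.ofReal_le_ofReal_iff (by positivity)] at h3
  nth_rewrite 1 [← Real.rpow_one 2] at h3
  rw [Real.rpow_le_rpow_left_iff one_lt_two] at h3
  linarith

/-! ### Summation over dyadic cubes -/

/-- The constant in the estimate of `∫ (1 + R|x - y|)^{-(n + 1/2)} w_v(x) dx`. -/
def kernelConst (n : ℕ) : ℝ≥0∞ :=
  ENNReal.ofReal (2 ^ ((n : ℝ) + 1 / 2) * 4 ^ n) *
    (1 - ENNReal.ofReal (2 ^ (-(1 / 2) : ℝ)))⁻¹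

theorem kernelConst_ne_top (n : ℕ) : kernelConst n ≠ ⊤ := by
  refine ENNReal.mul_ne_top ENNReal.ofReal_ne_top (ENNReal.inv_ne_top.2 (tsub_pos_of_lt ?_).ne')
  rw [ENNReal.ofReal_lt_one]
  exact Real.rpow_lt_one_of_one_lt_of_neg one_lt_two (by norm_num)

/-- The lattice cube of side `4s`, with centre in `s ℤⁿ`. -/
def latticeCube (s : ℝ) (m : Fin n → ℤ) : Set (Rn n) :=
  cube (WithLp.toLp 2 fun i => s * m i) (4 * s)

/-- Cubes centred at y would give uncountably many exceptional null sets; lattice cubes give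
countably many. Rounding moves each coordinate of the centre by at most s/2, so the ball stays
within 3s/2 < 2s of it coordinatewise. -/
theorem exists_ball_subset_latticeCube {s : ℝ} (hs : 0 < s) (y : Rn n) :
    ∃ m, ∀ x : Rn n, ‖x - y‖ < s → x ∈ latticeCube s m := by
  refine ⟨fun i => round (y i / s), fun x hx i => ?_⟩
  have h1 : |x i - y i| < s := (PiLp.norm_apply_le (x - y) i).trans_lt hx
  have h2 := abs_sub_round (y i / s)
  have h3 : |y i - s * round (y i / s)| ≤ s / 2 := by
    have : y i - s * round (y i / s) = s * (y i / s - round (y i / s)) := by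
      field_simp
    rw [this, abs_mul, abs_of_pos hs]
    nlinarith
  rw [abs_lt] at h1
  rw [abs_le] at h3
  simp only
  constructor <;> linarith

theorem exists_pow_two_gt {t : ℝ} (ht : 0 ≤ t) : ∃ j : ℕ, t < 2 ^ j ∧ (2 : ℝ) ^ j / 2 ≤ 1 + t := by
  classical
  have hex : ∃ j : ℕ, t < 2 ^ j := pow_unbounded_of_one_lt t one_lt_two
  refine ⟨Nat.find hex, Nat.find_spec hex, ?_⟩
  rcases Nat.eq_zero_or_pos (Nat.find hex) with h | h
  · rw [h]
    norm_num
    linarith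
  · obtain ⟨k, hk⟩ := Nat.exists_eq_succ_of_ne_zero h.ne'
    have h1 : (2 : ℝ) ^ k ≤ t := not_lt.1 (Nat.find_min hex (by omega))
    rw [hk, pow_succ]
    linarith

theorem ae_lintegral_kernel_mul_scalarWeight_le (hW : IsMatrixWeight W) (hp : 0 < p) {A : ℝ≥0∞}
    (hA : apConst p W = A) {R : ℝ} (hR : 0 < R) :
    ∀ᵐ y, ∀ v : CN N,
      ∫⁻ x, ENNReal.ofReal ((1 + R * ‖x - y‖) ^ (-((n : ℝ) + 1 / 2))) * scalarWeight p W v x ≤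
        kernelConst n * A * ENNReal.ofReal ((R ^ n)⁻¹) * scalarWeight p W v y := by
  set q : ℝ := (n : ℝ) + 1 / 2 with hq
  have hq0 : 0 < q := by positivity
  have hs : ∀ j : ℕ, 0 < (2 : ℝ) ^ j / R := fun j => by positivity
  have hae : ∀ᵐ y, ∀ (j : ℕ) (m : Fin n → ℤ), y ∈ latticeCube (2 ^ j / R) m → ∀ v : CN N,
      ∫⁻ t in latticeCube (2 ^ j / R) m, scalarWeight p W v t ≤
        A * ENNReal.ofReal (4 * (2 ^ j / R)) ^ n * scalarWeight p W v y := by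
    rw [ae_all_iff]
    intro j
    rw [ae_all_iff]
    intro m
    exact ae_setLIntegral_scalarWeight_le hW hp hA (mul_pos four_pos (hs j)) _
  filter_upwards [hae] with y hy v
  choose m hm using fun j : ℕ => exists_ball_subset_latticeCube (hs j) y
  have hmeas : ∀ j, MeasurableSet (latticeCube (2 ^ j / R) (m j)) :=
    fun j => measurableSet_cube _ _
  set c : ℕ → ℝ≥0∞ := fun j => ENNReal.ofReal (((2 : ℝ) ^ j / 2) ^ (-q)) with hc
  -- The j chosen for x makes 2^j comparable to 1 + R|x - y|, so the single term of index j
  -- dominates the kernel at x.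
  have hpt : ∀ x, ENNReal.ofReal ((1 + R * ‖x - y‖) ^ (-q)) * scalarWeight p W v x ≤
      ∑' j, c j * (latticeCube (2 ^ j / R) (m j)).indicator (scalarWeight p W v) x := by
    intro x
    obtain ⟨j, hj1, hj2⟩ := exists_pow_two_gt (t := R * ‖x - y‖) (by positivity)
    refine le_trans ?_ (ENNReal.le_tsum j)
    rw [Set.indicator_of_mem (hm j x (by rwa [lt_div_iff₀' hR]))]
    exact mul_le_mul_left (ENNReal.ofReal_le_ofReal
      (Real.rpow_le_rpow_of_nonpos (by positivity) hj2 (by linarith))) _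
  -- The decay 2^{-j(n+1/2)} against the volume growth 2^{jn} leaves the ratio 2^{-1/2}; the surplus
  -- 1/2 in the exponent is what makes the series geometric.
  have hterm : ∀ j : ℕ, c j * ENNReal.ofReal (4 * (2 ^ j / R)) ^ n =
      ENNReal.ofReal (2 ^ q * 4 ^ n) * ENNReal.ofReal ((R ^ n)⁻¹) *
        ENNReal.ofReal (2 ^ (-(1 / 2) : ℝ)) ^ j := by
    intro j
    rw [hc]
    dsimp only
    rw [← ENNReal.ofReal_pow (by positivity), ← ENNReal.ofReal_pow (by positivity),
      ← ENNReal.ofReal_mul (by positivity), ← ENNReal.ofReal_mul (by positivity),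
      ← ENNReal.ofReal_mul (by positivity)]
    congr 1
    have h1 : ((2 : ℝ) ^ j / 2) ^ (-q) = 2 ^ q * ((2 : ℝ) ^ (-q)) ^ j := by
      rw [Real.div_rpow (by positivity) (by positivity), ← Real.rpow_natCast,
        ← Real.rpow_natCast, ← Real.rpow_mul two_pos.le, ← Real.rpow_mul two_pos.le,
        Real.rpow_neg two_pos.le q, div_inv_eq_mul, mul_comm, mul_comm (j : ℝ)]
    have h2 : (2 : ℝ) ^ (-(1 / 2) : ℝ) = 2 ^ (-q) * 2 ^ n := by
      rw [← Real.rpow_natCast 2 n, ← Real.rpow_add two_pos, hq]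
      congr 1
      ring
    rw [h1, h2, mul_pow, mul_pow, div_pow, ← pow_mul, ← pow_mul, mul_comm j n]
    field_simp
  calc ∫⁻ x, ENNReal.ofReal ((1 + R * ‖x - y‖) ^ (-q)) * scalarWeight p W v x
      ≤ ∫⁻ x, ∑' j, c j *
          (latticeCube (2 ^ j / R) (m j)).indicator (scalarWeight p W v) x := lintegral_mono hpt
    _ = ∑' j, c j * ∫⁻ t in latticeCube (2 ^ j / R) (m j), scalarWeight p W v t := by
        rw [lintegral_tsum fun j => ((hW.aemeasurable_scalarWeight hp v).indicator
          (hmeas j)).const_mul _]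
        congr 1
        ext j
        rw [lintegral_const_mul' _ _ ENNReal.ofReal_ne_top, lintegral_indicator (hmeas j)]
    _ ≤ ∑' j, c j * (A * ENNReal.ofReal (4 * (2 ^ j / R)) ^ n * scalarWeight p W v y) := by
        gcongr with j
        refine hy j (m j) (hm j y ?_) v
        rw [sub_self, norm_zero]
        exact hs j
    _ = ∑' j, (ENNReal.ofReal (2 ^ q * 4 ^ n) * ENNReal.ofReal ((R ^ n)⁻¹) * A *
          scalarWeight p W v y) * ENNReal.ofReal (2 ^ (-(1 / 2) : ℝ)) ^ j := by
        congr 1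
        ext j
        calc _ = (c j * ENNReal.ofReal (4 * (2 ^ j / R)) ^ n) * (A * scalarWeight p W v y) := by
              ring
          _ = _ := by
              rw [hterm]
              ring
    _ = _ := by
        rw [ENNReal.tsum_mul_left, ENNReal.tsum_geometric, kernelConst]
        ring

end

noncomputable section

variable {n N : ℕ}

/-! ### The multiplier as a convolution -/

/-- Fubini turns multiplication by ψ on the Fourier side into integration against the kernel `oscInt
ψ (z - y)`; it is applied to the mollified multiplier. -/
theorem oscInt_mul_invFourierSchwartz {ψ : Rn n → ℂ} (hψ : Integrable ψ) (u : 𝓢(Rn n, ℂ))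
    (y : Rn n) : oscInt (fun ξ => ψ ξ * invFourierSchwartz n u ξ) (-y) =
      fourierFactor n * ∫ z, u z * oscInt ψ (z - y) := by
  have hint : Integrable (Function.uncurry fun (ξ z : Rn n) =>
      Complex.exp (Complex.I * (inner ℝ (z - y) ξ : ℝ)) * (ψ ξ * u z)) (volume.prod volume) := by
    refine (hψ.mul_prod u.integrable).bdd_mul (c := 1)
      (f := fun w : Rn n × Rn n => Complex.exp (Complex.I * (inner ℝ (w.2 - y) w.1 : ℝ))) ?_ ?_
    · apply Continuous.aestronglyMeasurable
      fun_prop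
    · exact Eventually.of_forall fun w => by simp only [norm_exp_I_mul, le_refl]
  calc oscInt (fun ξ => ψ ξ * invFourierSchwartz n u ξ) (-y)
      = ∫ ξ, fourierFactor n * ∫ z,
          Complex.exp (Complex.I * (inner ℝ (z - y) ξ : ℝ)) * (ψ ξ * u z) := by
        rw [oscInt]
        congr 1
        ext ξ
        rw [invFourierSchwartz_apply, invFourierFun_eq_oscInt, oscInt, ← mul_assoc, ← mul_assoc,
          mul_comm _ (fourierFactor n), mul_assoc, ← integral_const_mul]
        congr 2
        ext z
        rw [inner_sub_left, inner_neg_left, real_inner_comm z ξ, sub_eq_add_neg]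
        push_cast
        rw [mul_add, Complex.exp_add]
        ring
    _ = fourierFactor n * ∫ z, ∫ ξ,
          Complex.exp (Complex.I * (inner ℝ (z - y) ξ : ℝ)) * (ψ ξ * u z) := by
        rw [integral_const_mul, integral_integral_swap hint]
    _ = _ := by
        congr 2
        ext z
        rw [oscInt, ← integral_const_mul]
        congr 1
        ext ξ
        ring

theorem measurable_comp_sub {f : Rn n → ℂ} (hf : AEStronglyMeasurable f volume)
    {φ : Rn n → ℂ} (hφ : Integrable φ) :
    AEStronglyMeasurable (fun w : Rn n × Rn n => oscInt φ (w.1 - w.2) * f w.2)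
      (volume.prod volume) :=
  ((continuous_oscInt hφ).comp (continuous_fst.sub continuous_snd)).aestronglyMeasurable.mul
    hf.comp_snd

/-- If the convolution of `F⁻¹φ` with `f` converges absolutely and has polynomial growth, then
it is `φ(D) f`. -/
theorem isMultiplier_of_lintegral_le {φ f : Rn n → ℂ} {T : 𝓢'(Rn n, ℂ)}
    (hTf : IsRepresentedBy T f) (hT : ∀ g : 𝓢(Rn n, ℂ), T g = ∫ x, g x * f x)
    (hφ : Integrable φ) (hφc : HasCompactSupport φ) {C : ℝ} {L : ℕ} (hC0 : 0 ≤ C)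
    (hC : ∀ x, ∫⁻ y, ‖oscInt φ (x - y)‖ₑ * ‖f y‖ₑ ≤ ENNReal.ofReal (C * (1 + ‖x‖) ^ L)) :
    IsMultiplier φ f fun x =>
      (fourierFactor n * fourierFactor n) * ∫ y, oscInt φ (x - y) * f y := by
  have hfm := hTf.1.aestronglyMeasurable
  have hprodm := measurable_comp_sub hfm hφ
  set h₀ : Rn n → ℂ := fun x => ∫ y, oscInt φ (x - y) * f y with hh₀
  set c := fourierFactor n
  have hh₀m : AEStronglyMeasurable h₀ volume := hprodm.integral_prod_right'
  have hh₀b : ∀ x, ‖h₀ x‖ ≤ C * (1 + ‖x‖) ^ L := by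
    intro x
    rw [← ENNReal.ofReal_le_ofReal_iff (by positivity), ofReal_norm]
    refine (enorm_integral_le_lintegral_enorm _).trans (le_trans (le_of_eq ?_) (hC x))
    simp only [enorm_mul]
  have hhm : AEStronglyMeasurable (fun x => c * c * h₀ x) volume := hh₀m.const_mul _
  have hhb : ∀ x, ‖c * c * h₀ x‖ ≤ C * (1 + ‖x‖) ^ L := by
    intro x
    have hc := norm_fourierFactor_le_one n
    rw [norm_mul, norm_mul]
    refine le_trans (mul_le_of_le_one_left (norm_nonneg _) ?_) (hh₀b x)
    exact mul_le_one₀ hc (norm_nonneg _) hc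
  obtain ⟨H, hH⟩ := exists_temperedDistribution_of_growth hhm (Eventually.of_forall hhb)
  -- The candidate for the product φ · F f is the Fourier transform of the convolution, regarded as
  -- the distribution H.
  refine ⟨T, fourierDist H, hTf, fun ρ hρ hρc hρ0 hρ1 => ?_, ?_, fun g _ => ?_⟩
  · rw [PointwiseConvergenceCLM.tendsto_iff_forall_tendsto]
    intro g
    set u := fourierSchwartz n g with hu
    have hgu : g = invFourierSchwartz n u := (invFourierSchwartz_fourierSchwartz g).symm
    let F : Rn n × Rn n → ℂ := fun w => u w.1 * (oscInt φ (w.1 - w.2) * f w.2)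
    have hFm : AEStronglyMeasurable F (volume.prod volume) :=
      (u.continuous.comp continuous_fst).aestronglyMeasurable.mul hprodm
    have hF : Integrable F (volume.prod volume) := by
      refine ⟨hFm, ?_⟩
      rw [HasFiniteIntegral, lintegral_prod _ hFm.enorm]
      have hgi : Integrable fun x => C * ((1 + ‖x‖) ^ L * ‖u x‖) :=
        (integrable_one_add_pow_mul_norm L u).const_mul C
      refine lt_of_le_of_lt (lintegral_mono fun x => ?_) hgi.2
      calc ∫⁻ y, ‖F (x, y)‖ₑ = ‖u x‖ₑ * ∫⁻ y, ‖oscInt φ (x - y)‖ₑ * ‖f y‖ₑ := by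
            rw [← lintegral_const_mul' _ _ enorm_ne_top]
            simp only [F, enorm_mul]
        _ ≤ ‖u x‖ₑ * ENNReal.ofReal (C * (1 + ‖x‖) ^ L) := by
            gcongr
            exact hC x
        _ = _ := by
            rw [← ofReal_norm, ← ofReal_norm (C * _), ← ENNReal.ofReal_mul (norm_nonneg _),
              Real.norm_of_nonneg (by positivity)]
            congr 1
            ring
    let m : ℝ → Rn n → ℂ := fun ε z => oscInt (fun ξ => (ρ ξ : ℂ)) (ε • z)
    have hρi := integrable_of_contDiff_hasCompactSupport hρ hρc
    have hm1 : ∀ ε z, ‖m ε z‖ ≤ 1 := fun ε z => norm_oscInt_ofReal_le_one hρ0 hρ1 _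
    have hmF : ∀ ε, AEStronglyMeasurable (fun w : Rn n × Rn n => m ε (w.1 - w.2) * F w)
        (volume.prod volume) := fun ε =>
      ((continuous_oscInt hρi.ofReal).comp
        ((continuous_fst.sub continuous_snd).const_smul ε)).aestronglyMeasurable.mul hFm
    have hmFb : ∀ ε w, ‖m ε (w.1 - w.2) * F w‖ ≤ ‖F w‖ := fun ε w => by
      rw [norm_mul]
      exact mul_le_of_le_one_left (norm_nonneg _) (hm1 _ _)
    -- Mollifying φ only inserts the factor m ε (x - y) into the absolutely convergent double
    -- integral of F, so dominated convergence gives the limit for every ρ.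
    have happ : ∀ ε : ℝ, 0 < ε → TemperedDistribution.smulLeftCLM ℂ (mollify ρ ε φ)
        (fourierDist T) g =
        c * c * ∫ w, m ε (w.1 - w.2) * F w ∂(volume.prod volume) := by
      intro ε hε
      have hcd := contDiff_mollify hρ hρc hε.ne' hφ
      have hcs : HasCompactSupport (mollify ρ ε φ) :=
        (hasCompactSupport_dilate hρc hε.ne').convolution _ hφc
      have hψi : Integrable (mollify ρ ε φ) := hcd.continuous.integrable_of_hasCompactSupport hcs
      have h1 : TemperedDistribution.smulLeftCLM ℂ (mollify ρ ε φ) (fourierDist T) g =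
          T (fourierSchwartz n (SchwartzMap.smulLeftCLM ℂ (mollify ρ ε φ) g)) := rfl
      have h2 : ⇑(SchwartzMap.smulLeftCLM ℂ (mollify ρ ε φ) g) =
          fun ξ => mollify ρ ε φ ξ * invFourierSchwartz n u ξ := by
        rw [← hgu]
        exact SchwartzMap.smulLeftCLM_apply (hcs.hasTemperateGrowth hcd) g
      rw [h1, hT, integral_prod_symm _ (hF.mono (hmF ε) (Eventually.of_forall (hmFb ε))),
        ← integral_const_mul]
      congr 1
      ext y
      rw [fourierSchwartz_eq_oscInt, h2, oscInt_mul_invFourierSchwartz hψi, ← mul_assoc,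
        mul_assoc, ← integral_mul_const]
      congr 2
      ext z
      rw [oscInt_mollify hρ hρc hε hφ]
      simp only [F, m]
      ring
    have hlim : fourierDist H g = c * c * ∫ w, F w ∂(volume.prod volume) := by
      have h1 : fourierDist H g = H u := rfl
      rw [h1, hH, integral_prod _ hF, ← integral_const_mul]
      congr 1
      ext x
      simp only [F]
      rw [integral_const_mul]
      ring
    rw [hlim]
    have ht : Tendsto (fun ε => ∫ w, m ε (w.1 - w.2) * F w ∂(volume.prod volume)) (𝓝[>] 0)
        (𝓝 (∫ w, F w ∂(volume.prod volume))) := by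
      refine tendsto_integral_filter_of_dominated_convergence (fun w => ‖F w‖)
        (Eventually.of_forall hmF)
        (Eventually.of_forall fun ε => Eventually.of_forall (hmFb ε)) hF.norm
        (Eventually.of_forall fun w => ?_)
      have := (tendsto_oscInt_ofReal hρi hρ1 (w.1 - w.2)).mul_const (F w)
      rw [one_mul] at this
      exact this.mono_left nhdsWithin_le_nhds
    refine (ht.const_mul (c * c)).congr' ?_
    filter_upwards [self_mem_nhdsWithin] with ε hε
    exact (happ ε hε).symm
  · have hcont : Continuous fun x : Rn n => C * (1 + ‖x‖) ^ L := by fun_prop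
    refine hcont.locallyIntegrable.mono hhm (Eventually.of_forall fun x => ?_)
    exact (hhb x).trans (le_abs_self _)
  · have h1 : invFourierDist (fourierDist H) g = H (fourierSchwartz n (invFourierSchwartz n g)) :=
      rfl
    rw [h1, fourierSchwartz_invFourierSchwartz, hH]

/-! ### Polynomial growth of the convolution -/

/-- A Peetre-type inequality: the base point of the kernel may be moved from x to x₀ at polynomial
cost, since 1 + R|x₀ - y| ≤ (1 + R|x - x₀|)(1 + R|x - y|). -/
theorem one_add_mul_norm_sub_rpow_neg_le {R q : ℝ} (hR : 0 ≤ R) (hq : 0 ≤ q) (x x₀ y : Rn n) :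
    (1 + R * ‖x - y‖) ^ (-q) ≤ (1 + R * ‖x - x₀‖) ^ q * (1 + R * ‖x₀ - y‖) ^ (-q) := by
  have h1 : 1 + R * ‖x₀ - y‖ ≤ (1 + R * ‖x - x₀‖) * (1 + R * ‖x - y‖) := by
    have h2 : ‖x₀ - y‖ ≤ ‖x - x₀‖ + ‖x - y‖ := by
      calc ‖x₀ - y‖ = ‖(x - y) - (x - x₀)‖ := by congr 1; abel
        _ ≤ _ := (norm_sub_le _ _).trans (le_of_eq (add_comm _ _))
    have h3 : 0 ≤ R * ‖x - x₀‖ * (R * ‖x - y‖) := by positivity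
    nlinarith
  have ha : (0 : ℝ) < 1 + R * ‖x - y‖ := by positivity
  have hb : (0 : ℝ) < 1 + R * ‖x₀ - y‖ := by positivity
  rw [Real.rpow_neg ha.le, Real.rpow_neg hb.le, ← div_eq_mul_inv, inv_eq_one_div,
    div_le_div_iff₀ (by positivity) (by positivity), one_mul,
    ← Real.mul_rpow (by positivity) ha.le]
  exact Real.rpow_le_rpow hb.le h1 hq

/-- Nikolskii's inequality with the identity matrix passes to p-th powers, and moving the base point
spreads finiteness at the single point x₀ to polynomial growth in x. -/
theorem IsBandlimited.exists_lintegral_le {R : ℝ} (hR : 0 < R) {f : Rn n → CN N}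
    (hf : IsBandlimited R f) {φ : Rn n → ℂ} (hφ : Integrable φ)
    (hφR : Function.support φ ⊆ Metric.ball 0 R) {p : ℝ} (hp0 : 0 < p) (hp1 : p ≤ 1)
    {q : ℝ} (hq : 0 ≤ q) {D : ℝ≥0∞} (hD : D ≠ ⊤)
    (hdec : ∀ x, ‖oscInt φ x‖ₑ ^ p ≤ D * ENNReal.ofReal ((1 + R * ‖x‖) ^ (-q))) {x₀ : Rn n}
    (hx₀ : ∫⁻ y, ENNReal.ofReal ((1 + R * ‖x₀ - y‖) ^ (-q)) * ‖f y‖ₑ ^ p ≠ ⊤) :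
    ∃ (C : ℝ) (L : ℕ), 0 ≤ C ∧ ∀ x, ∫⁻ y, ‖oscInt φ (x - y)‖ₑ * ‖f y‖ₑ ≤
      ENNReal.ofReal (C * (1 + ‖x‖) ^ L) := by
  set B := ∫⁻ y, ENNReal.ofReal ((1 + R * ‖x₀ - y‖) ^ (-q)) * ‖f y‖ₑ ^ p with hB
  set V := volume (Metric.ball (0 : Rn n) (3 * R)) ^ (1 - p) with hV
  have hVt : V ≠ ⊤ := ENNReal.rpow_ne_top_of_nonneg (by linarith) measure_ball_lt_top.ne
  set Y := V * D * B with hY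
  have hYt : Y ≠ ⊤ := ENNReal.mul_ne_top (ENNReal.mul_ne_top hVt hD) hx₀
  have key : ∀ x, (∫⁻ y, ‖oscInt φ (x - y)‖ₑ * ‖f y‖ₑ) ^ p ≤
      Y * ENNReal.ofReal ((1 + R * ‖x - x₀‖) ^ q) := by
    intro x
    have h1 := hf.lintegral_mul_enorm_rpow_le hR hφ hφR (ContinuousLinearMap.id ℂ _) x hp0 hp1
    simp only [ContinuousLinearMap.id_apply] at h1
    refine h1.trans ?_
    calc V * ∫⁻ y, (‖oscInt φ (x - y)‖ₑ * ‖f y‖ₑ) ^ p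
        ≤ V * ∫⁻ y, (D * ENNReal.ofReal ((1 + R * ‖x - x₀‖) ^ q)) *
            (ENNReal.ofReal ((1 + R * ‖x₀ - y‖) ^ (-q)) * ‖f y‖ₑ ^ p) := by
          refine mul_le_mul_right (lintegral_mono fun y => ?_) _
          rw [ENNReal.mul_rpow_of_nonneg _ _ hp0.le, ← mul_assoc]
          refine mul_le_mul_left ((hdec (x - y)).trans ?_) _
          rw [mul_assoc, ← ENNReal.ofReal_mul (by positivity)]
          exact mul_le_mul_right (ENNReal.ofReal_le_ofReal
            (one_add_mul_norm_sub_rpow_neg_le hR.le hq x x₀ y)) _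
      _ = _ := by
          rw [lintegral_const_mul' _ _ (ENNReal.mul_ne_top hD ENNReal.ofReal_ne_top), hY]
          ring
  -- Chosen so that 1 + R|x - x₀| ≤ a(1 + |x|); the exponent q/p is then rounded up to an integer.
  set a := 1 + R + R * ‖x₀‖ with ha
  have ha1 : 1 ≤ a := by
    have : 0 ≤ R * ‖x₀‖ := by positivity
    linarith
  set L := ⌈q / p⌉₊ with hL
  refine ⟨Y.toReal ^ (1 / p) * a ^ L, L, by positivity, fun x => ?_⟩
  have h2 := (ENNReal.le_rpow_inv_iff hp0).2 (key x)
  refine h2.trans ?_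
  have h3 : Y * ENNReal.ofReal ((1 + R * ‖x - x₀‖) ^ q) =
      ENNReal.ofReal (Y.toReal * (1 + R * ‖x - x₀‖) ^ q) := by
    rw [ENNReal.ofReal_mul ENNReal.toReal_nonneg, ENNReal.ofReal_toReal hYt]
  rw [h3, ENNReal.ofReal_rpow_of_nonneg (by positivity) (by positivity)]
  refine ENNReal.ofReal_le_ofReal ?_
  rw [Real.mul_rpow (by positivity) (by positivity), ← Real.rpow_mul (by positivity), ← one_div,
    mul_assoc]
  refine mul_le_mul_of_nonneg_left ?_ (by positivity)
  rw [← mul_pow, ← Real.rpow_natCast (a * (1 + ‖x‖)), mul_one_div]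
  have h4 : 1 + R * ‖x - x₀‖ ≤ a * (1 + ‖x‖) := by
    have h5 : R * ‖x - x₀‖ ≤ R * (‖x‖ + ‖x₀‖) := by
      gcongr
      exact norm_sub_le _ _
    have h6 : 0 ≤ R * ‖x₀‖ * ‖x‖ := by positivity
    have h7 := norm_nonneg x
    rw [ha]
    nlinarith
  have h8 : 1 ≤ a * (1 + ‖x‖) := by
    have : 0 ≤ R * ‖x - x₀‖ := by positivity
    linarith
  calc (1 + R * ‖x - x₀‖) ^ (q / p) ≤ (a * (1 + ‖x‖)) ^ (q / p) :=
        Real.rpow_le_rpow (by positivity) h4 (by positivity)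
    _ ≤ _ := Real.rpow_le_rpow_of_exponent_le h8 (Nat.le_ceil _)

end

/-! ### Weighted kernel estimates and the dependence on R -/

noncomputable section

variable {n N : ℕ} {W : Rn n → Matrix (Fin N) (Fin N) ℂ} {p : ℝ}

/-- The kernel `(1 + R|x - y|)^{-(n + 1/2)}`. -/
def decayKernel (R : ℝ) (x y : Rn n) : ℝ≥0∞ :=
  ENNReal.ofReal ((1 + R * ‖x - y‖) ^ (-((n : ℝ) + 1 / 2)))

theorem measurable_decayKernel (R : ℝ) :
    Measurable fun z : Rn n × Rn n => decayKernel R z.1 z.2 := by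
  unfold decayKernel
  fun_prop

theorem aemeasurable_decayKernel_mul (hW : IsMatrixWeight W) (hp : 0 < p) {f : Rn n → CN N}
    (hf : AEStronglyMeasurable f volume) (R : ℝ) :
    AEMeasurable (Function.uncurry fun x y => decayKernel R x y * scalarWeight p W (f y) x)
      (volume.prod volume) := by
  refine (measurable_decayKernel R).aemeasurable.mul ?_
  have h1 : AEStronglyMeasurable (fun z : Rn n × Rn n => toOp (matPow (W z.1) (1 / p)))
      (volume.prod volume) := (hW.aestronglyMeasurable_toOp hp).comp_fst
  have h2 : AEStronglyMeasurable (fun z : Rn n × Rn n => f z.2) (volume.prod volume) :=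
    hf.comp_snd
  have h3 : Continuous fun z : (CN N →L[ℂ] CN N) × CN N => z.1 z.2 :=
    isBoundedBilinearMap_apply.continuous
  exact (h3.comp_aestronglyMeasurable (h1.prodMk h2)).enorm.pow_const p

/-- After Tonelli y is frozen in the inner integral, so f(y) is a constant vector. Taking v = f(y)
is legitimate because the exceptional set of the A₁ estimate does not depend on v. -/
theorem lintegral_lintegral_decayKernel_le (hW : IsMatrixWeight W) (hp : 0 < p) {A : ℝ≥0}
    (hA : apConst p W = A) {R : ℝ} (hR : 0 < R) {f : Rn n → CN N}
    (hf : AEStronglyMeasurable f volume) :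
    ∫⁻ x, ∫⁻ y, decayKernel R x y * scalarWeight p W (f y) x ≤
      kernelConst n * A * ENNReal.ofReal ((R ^ n)⁻¹) * ∫⁻ y, scalarWeight p W (f y) y := by
  rw [lintegral_lintegral_swap (aemeasurable_decayKernel_mul hW hp hf R),
    ← lintegral_const_mul' _ _ (ENNReal.mul_ne_top (ENNReal.mul_ne_top (kernelConst_ne_top n)
      ENNReal.coe_ne_top) ENNReal.ofReal_ne_top)]
  refine lintegral_mono_ae ?_
  filter_upwards [ae_lintegral_kernel_mul_scalarWeight_le hW hp hA hR] with y hy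
  exact hy (f y)

/-- The inner integral is finite at almost every x; at such an x₀ with W(x₀) positive definite, the
norm of W(x₀)^{-1/p} removes the weight. -/
theorem exists_lintegral_decayKernel_ne_top (hW : IsMatrixWeight W) (hp : 0 < p) {A : ℝ≥0}
    (hA : apConst p W = A) {R : ℝ} (hR : 0 < R) {f : Rn n → CN N}
    (hf : AEStronglyMeasurable f volume) (hfin : ∫⁻ y, scalarWeight p W (f y) y ≠ ⊤) :
    ∃ x₀, ∫⁻ y, decayKernel R x₀ y * ‖f y‖ₑ ^ p ≠ ⊤ := by
  have hJ : ∫⁻ x, ∫⁻ y, decayKernel R x y * scalarWeight p W (f y) x ≠ ⊤ :=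
    ne_top_of_le_ne_top (ENNReal.mul_ne_top (ENNReal.mul_ne_top (ENNReal.mul_ne_top
      (kernelConst_ne_top n) ENNReal.coe_ne_top) ENNReal.ofReal_ne_top) hfin)
      (lintegral_lintegral_decayKernel_le hW hp hA hR hf)
  have hlt := ae_lt_top' (aemeasurable_decayKernel_mul hW hp hf R).lintegral_prod_right' hJ
  obtain ⟨x₀, hx₀, hpos⟩ := (hlt.and hW.posDef).exists
  refine ⟨x₀, ?_⟩
  set Q := toOp (matPow (W x₀) (-(1 / p))) with hQ
  refine ne_top_of_le_ne_top (ENNReal.mul_ne_top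
    (ENNReal.rpow_ne_top_of_nonneg hp.le (enorm_ne_top (x := Q))) hx₀.ne) ?_
  rw [← lintegral_const_mul' _ _ (ENNReal.rpow_ne_top_of_nonneg hp.le enorm_ne_top)]
  refine lintegral_mono fun y => ?_
  have h1 : ‖f y‖ₑ ≤ ‖Q‖ₑ * ‖toOp (matPow (W x₀) (1 / p)) (f y)‖ₑ := by
    conv_lhs => rw [← toOp_matPow_neg_apply hpos (1 / p) (f y)]
    exact ContinuousLinearMap.le_opENorm _ _
  calc decayKernel R x₀ y * ‖f y‖ₑ ^ p
      ≤ decayKernel R x₀ y * (‖Q‖ₑ * ‖toOp (matPow (W x₀) (1 / p)) (f y)‖ₑ) ^ p := by gcongr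
    _ = ‖Q‖ₑ ^ p * (decayKernel R x₀ y * scalarWeight p W (f y) x₀) := by
        rw [ENNReal.mul_rpow_of_nonneg _ _ hp.le, scalarWeight]
        ring

/-- Weakening the decay to the exponent (n + 1/2)/p removes M, and with it β, from all later
constants. -/
theorem enorm_invFourierFun_rpow_le {φ : Rn n → ℂ} {K R M : ℝ} (hp : 0 < p) (hR : 0 < R)
    (hM : ((n : ℝ) + 1 / 2) / p ≤ M)
    (hφ : ∀ x : Rn n, ‖invFourierFun φ x‖ ≤ K * R ^ n * (1 + R * ‖x‖) ^ (-M)) (x : Rn n) :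
    ‖invFourierFun φ x‖ₑ ^ p ≤ ENNReal.ofReal (K * R ^ n) ^ p *
      ENNReal.ofReal ((1 + R * ‖x‖) ^ (-((n : ℝ) + 1 / 2))) := by
  have h1 : (1 : ℝ) ≤ 1 + R * ‖x‖ := by
    have : 0 ≤ R * ‖x‖ := by positivity
    linarith
  -- The real number K is arbitrary, but the assumed bound forces this sign.
  have h2 : 0 ≤ K * R ^ n :=
    nonneg_of_mul_nonneg_left ((norm_nonneg _).trans (hφ x)) (by positivity)
  have h3 : ENNReal.ofReal ((1 + R * ‖x‖) ^ (-((n : ℝ) + 1 / 2))) =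
      ENNReal.ofReal ((1 + R * ‖x‖) ^ (-(((n : ℝ) + 1 / 2) / p))) ^ p := by
    rw [ENNReal.ofReal_rpow_of_nonneg (by positivity) hp.le, ← Real.rpow_mul (by positivity)]
    congr 2
    field_simp
  rw [h3, ← ENNReal.mul_rpow_of_nonneg _ _ hp.le, ← ENNReal.ofReal_mul h2]
  refine ENNReal.rpow_le_rpow ?_ hp.le
  rw [← ofReal_norm]
  refine ENNReal.ofReal_le_ofReal ((hφ x).trans ?_)
  gcongr

theorem volume_ball_three_mul_rpow {R : ℝ} (hR : 0 < R) (s : ℝ) (hs : 0 ≤ s) :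
    volume (Metric.ball (0 : Rn n) (3 * R)) ^ s = ENNReal.ofReal (R ^ n) ^ s *
      (ENNReal.ofReal (3 ^ n) * volume (Metric.ball (0 : Rn n) 1)) ^ s := by
  rw [Measure.addHaar_ball_of_pos _ _ (by positivity), finrank_euclideanSpace_fin, mul_pow,
    mul_comm ((3 : ℝ) ^ n), ENNReal.ofReal_mul (by positivity), mul_assoc,
    ENNReal.mul_rpow_of_nonneg _ _ hs]

/-- Nikolskii contributes R^{n(1-p)}, the kernel R^{np} and the integration R^{-n}; the product is
one, so the final constant is independent of R. -/
theorem rescaling_constant {R K : ℝ} (hR : 0 < R) (hp0 : 0 < p) (V : ℝ≥0∞) :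
    ENNReal.ofReal (R ^ n) ^ (1 - p) * V * ENNReal.ofReal (K * R ^ n) ^ p *
      ENNReal.ofReal ((R ^ n)⁻¹) = V * ENNReal.ofReal K ^ p := by
  have hRn : 0 < R ^ n := by positivity
  set r := ENNReal.ofReal (R ^ n) with hr
  have hr0 : r ≠ 0 := (ENNReal.ofReal_pos.2 hRn).ne'
  have hrt : r ≠ ⊤ := ENNReal.ofReal_ne_top
  rw [ENNReal.ofReal_mul' hRn.le, ENNReal.mul_rpow_of_nonneg _ _ hp0.le,
    ENNReal.ofReal_inv_of_pos hRn, ← hr]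
  calc _ = (r ^ (1 - p) * r ^ p) * r⁻¹ * (V * ENNReal.ofReal K ^ p) := by ring
    _ = _ := by
      rw [← ENNReal.rpow_add _ _ hr0 hrt, sub_add_cancel, ENNReal.rpow_one,
        ENNReal.mul_inv_cancel hr0 hrt, one_mul]

/-- Pointwise bound for the convolution defining the multiplier, tested against a matrix. -/
theorem IsBandlimited.enorm_apply_integral_rpow_le {R : ℝ} (hR : 0 < R) {f : Rn n → CN N}
    (hf : IsBandlimited R f) {φ : Rn n → ℂ} (hφ : Integrable φ)
    (hφR : Function.support φ ⊆ Metric.ball 0 R) (hp0 : 0 < p) (hp1 : p ≤ 1)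
    {D : ℝ≥0∞} (hD : D ≠ ⊤)
    (hdec : ∀ x, ‖invFourierFun φ x‖ₑ ^ p ≤
      D * ENNReal.ofReal ((1 + R * ‖x‖) ^ (-((n : ℝ) + 1 / 2)))) (x : Rn n)
    (hint : Integrable fun y => oscInt φ (x - y) • f y) (B : CN N →L[ℂ] CN N) :
    ‖B ((fourierFactor n * fourierFactor n) • ∫ y, oscInt φ (x - y) • f y)‖ₑ ^ p ≤
      volume (Metric.ball (0 : Rn n) (3 * R)) ^ (1 - p) * D *
        ∫⁻ y, decayKernel R x y * ‖B (f y)‖ₑ ^ p := by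
  set c := fourierFactor n
  have hc1 : ‖c‖ₑ ≤ 1 := by
    rw [← ofReal_norm]
    exact ENNReal.ofReal_le_one.2 (norm_fourierFactor_le_one n)
  -- One factor c is discarded using |c| ≤ 1; the other is kept to turn `oscInt φ` into
  -- `invFourierFun φ`, whose decay is assumed.
  have h1 : ‖B ((c * c) • ∫ y, oscInt φ (x - y) • f y)‖ₑ ≤
      ‖c‖ₑ * ∫⁻ y, ‖oscInt φ (x - y)‖ₑ * ‖B (f y)‖ₑ := by
    rw [map_smul, ← B.integral_comp_comm hint, enorm_smul, enorm_mul]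
    refine mul_le_mul' (mul_le_of_le_one_left zero_le hc1)
      ((enorm_integral_le_lintegral_enorm _).trans (le_of_eq ?_))
    simp only [map_smul, enorm_smul]
  calc _ ≤ (‖c‖ₑ * ∫⁻ y, ‖oscInt φ (x - y)‖ₑ * ‖B (f y)‖ₑ) ^ p :=
        ENNReal.rpow_le_rpow h1 hp0.le
    _ = ‖c‖ₑ ^ p * (∫⁻ y, ‖oscInt φ (x - y)‖ₑ * ‖B (f y)‖ₑ) ^ p :=
        ENNReal.mul_rpow_of_nonneg _ _ hp0.le
    _ ≤ ‖c‖ₑ ^ p * (volume (Metric.ball (0 : Rn n) (3 * R)) ^ (1 - p) *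
          ∫⁻ y, (‖oscInt φ (x - y)‖ₑ * ‖B (f y)‖ₑ) ^ p) := by
        gcongr
        exact hf.lintegral_mul_enorm_rpow_le hR hφ hφR B x hp0 hp1
    _ = volume (Metric.ball (0 : Rn n) (3 * R)) ^ (1 - p) *
          ∫⁻ y, ‖c‖ₑ ^ p * (‖oscInt φ (x - y)‖ₑ * ‖B (f y)‖ₑ) ^ p := by
        rw [lintegral_const_mul' _ _ (ENNReal.rpow_ne_top_of_nonneg hp0.le enorm_ne_top)]
        ring
    _ ≤ volume (Metric.ball (0 : Rn n) (3 * R)) ^ (1 - p) *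
          ∫⁻ y, D * (decayKernel R x y * ‖B (f y)‖ₑ ^ p) := by
        refine mul_le_mul_right (lintegral_mono fun y => ?_) _
        rw [ENNReal.mul_rpow_of_nonneg _ _ hp0.le, ← mul_assoc, ← mul_assoc,
          ← ENNReal.mul_rpow_of_nonneg _ _ hp0.le, ← enorm_mul]
        exact mul_le_mul_left (hdec (x - y)) _
    _ = _ := by
        rw [lintegral_const_mul' _ _ hD, mul_assoc]

end

end MatrixWeight

open MatrixWeight in
theorem proposition2p1 (n N : ℕ) (hn : 0 < n) (hN : 0 < N) (p : ℝ) (hp0 : 0 < p) (hp1 : p ≤ 1)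
    (A : ℝ≥0) (K : ℝ) :
    ∃ C : ℝ≥0,
      ∀ W : Rn n → Matrix (Fin N) (Fin N) ℂ, IsMatrixWeight W → apConst p W = A →
      ∀ β : ℝ, IsDoublingExponent p W β →
      ∀ R M : ℝ, 0 < R → (n + β) / p < M →
      ∀ φ : Rn n → ℂ, Integrable φ volume → Function.support φ ⊆ Metric.ball 0 R →
        (∀ x : Rn n, ‖invFourierFun φ x‖ ≤ K * R ^ n * (1 + R * ‖x‖) ^ (-M)) →
      ∀ f : Rn n → CN N, IsBandlimited R f → MemLpW p W f →
        ∃ h : Rn n → CN N,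
          (∀ i, IsMultiplier φ (fun x => f x i) (fun x => h x i)) ∧
          weightedNorm p W h ≤ C * weightedNorm p W f := by
  set V := (ENNReal.ofReal (3 ^ n) * volume (Metric.ball (0 : Rn n) 1)) ^ (1 - p) with hV
  have hVt : V ≠ ⊤ := ENNReal.rpow_ne_top_of_nonneg (by linarith)
    (ENNReal.mul_ne_top ENNReal.ofReal_ne_top measure_ball_lt_top.ne)
  -- V comes from Nikolskii's inequality on a ball of radius 3R with the power of R split off, K^p
  -- from the kernel, and the last two factors from the dyadic A₁ sum.
  set C₀ : ℝ≥0∞ := V * ENNReal.ofReal K ^ p * kernelConst n * A with hC₀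
  have hC₀t : C₀ ≠ ⊤ := ENNReal.mul_ne_top (ENNReal.mul_ne_top (ENNReal.mul_ne_top hVt
    (ENNReal.rpow_ne_top_of_nonneg hp0.le ENNReal.ofReal_ne_top)) (kernelConst_ne_top n))
    ENNReal.coe_ne_top
  have hCt : C₀ ^ (1 / p) ≠ ⊤ := ENNReal.rpow_ne_top_of_nonneg (by positivity) hC₀t
  refine ⟨(C₀ ^ (1 / p)).toNNReal, ?_⟩
  intro W hW hA β hβ R M hR hM φ hφ hφR hK f hf hfW
  have hβ2 : 1 / 2 ≤ β := hβ.half_le hW hp0 hA hn hN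
  have hM' : ((n : ℝ) + 1 / 2) / p ≤ M := by
    refine le_trans ?_ hM.le
    gcongr
  set D := ENNReal.ofReal (K * R ^ n) ^ p with hD
  have hDt : D ≠ ⊤ := ENNReal.rpow_ne_top_of_nonneg hp0.le ENNReal.ofReal_ne_top
  have hdec := enorm_invFourierFun_rpow_le hp0 hR hM' hK
  have hfm := hfW.1
  have hfin : ∫⁻ y, scalarWeight p W (f y) y ≠ ⊤ :=
    ((ENNReal.rpow_lt_top_iff_of_pos (by positivity)).1 hfW.2).ne
  obtain ⟨x₀, hx₀⟩ := exists_lintegral_decayKernel_ne_top hW hp0 hA hR hfm hfin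
  -- This version serves only the qualitative growth bound, so its constant does not enter C₀.
  have hdec' : ∀ x, ‖oscInt φ x‖ₑ ^ p ≤ (‖(fourierFactor n)⁻¹‖ₑ ^ p * D) *
      ENNReal.ofReal ((1 + R * ‖x‖) ^ (-((n : ℝ) + 1 / 2))) := by
    intro x
    have h1 : oscInt φ x = (fourierFactor n)⁻¹ * invFourierFun φ x := by
      rw [invFourierFun_eq_oscInt, inv_mul_cancel_left₀ (fourierFactor_ne_zero n)]
    rw [h1, enorm_mul, ENNReal.mul_rpow_of_nonneg _ _ hp0.le, mul_assoc]
    gcongr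
    exact hdec x
  obtain ⟨C, L, hC0, hC⟩ := hf.exists_lintegral_le hR hφ hφR hp0 hp1 (by positivity)
    (ENNReal.mul_ne_top (ENNReal.rpow_ne_top_of_nonneg hp0.le enorm_ne_top) hDt) hdec' hx₀
  have hint : ∀ x, Integrable fun y => oscInt φ (x - y) • f y := by
    intro x
    refine ⟨((continuous_oscInt hφ).comp
      (continuous_const.sub continuous_id)).aestronglyMeasurable.smul hfm, ?_⟩
    rw [HasFiniteIntegral]
    simp only [enorm_smul]
    exact (hC x).trans_lt ENNReal.ofReal_lt_top
  refine ⟨fun x => (fourierFactor n * fourierFactor n) • ∫ y, oscInt φ (x - y) • f y,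
    fun i => ?_, ?_⟩
  · obtain ⟨T, _, _, hTf, _, _, _, hT⟩ := hf.exists_growth i
    have hCi : ∀ x, ∫⁻ y, ‖oscInt φ (x - y)‖ₑ * ‖f y i‖ₑ ≤ ENNReal.ofReal (C * (1 + ‖x‖) ^ L) := by
      intro x
      refine le_trans (lintegral_mono fun y => ?_) (hC x)
      gcongr
      rw [← ofReal_norm, ← ofReal_norm]
      exact ENNReal.ofReal_le_ofReal (PiLp.norm_apply_le (f y) i)
    have h1 := isMultiplier_of_lintegral_le hTf hT hφ
      (hasCompactSupport_of_support_subset_ball hφR) hC0 hCi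
    have h2 : (fun x => ((fourierFactor n * fourierFactor n) •
        ∫ y, oscInt φ (x - y) • f y) i) = fun x =>
        (fourierFactor n * fourierFactor n) * ∫ y, oscInt φ (x - y) * f y i := by
      ext x
      rw [PiLp.smul_apply, integral_euclidean_apply (hint x), smul_eq_mul]
      rfl
    rw [h2]
    exact h1
  · rw [ENNReal.coe_toNNReal hCt, weightedNorm, weightedNorm,
      ← ENNReal.mul_rpow_of_nonneg _ _ (by positivity)]
    refine ENNReal.rpow_le_rpow ?_ (by positivity)
    set V' := volume (Metric.ball (0 : Rn n) (3 * R)) ^ (1 - p) with hV'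
    have hVt' : V' ≠ ⊤ := ENNReal.rpow_ne_top_of_nonneg (by linarith) measure_ball_lt_top.ne
    calc _ ≤ ∫⁻ x, V' * D * ∫⁻ y, decayKernel R x y * scalarWeight p W (f y) x :=
          lintegral_mono fun x => hf.enorm_apply_integral_rpow_le hR hφ hφR hp0 hp1 hDt hdec x
            (hint x) (toOp (matPow (W x) (1 / p)))
      _ = V' * D * ∫⁻ x, ∫⁻ y, decayKernel R x y * scalarWeight p W (f y) x :=
          lintegral_const_mul' _ _ (ENNReal.mul_ne_top hVt' hDt)
      _ ≤ V' * D * (kernelConst n * A * ENNReal.ofReal ((R ^ n)⁻¹) *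
            ∫⁻ y, scalarWeight p W (f y) y) := by
          gcongr
          exact lintegral_lintegral_decayKernel_le hW hp0 hA hR hfm
      _ = (V' * D * ENNReal.ofReal ((R ^ n)⁻¹)) * kernelConst n * A *
            ∫⁻ y, scalarWeight p W (f y) y := by ring
      _ = C₀ * ∫⁻ y, scalarWeight p W (f y) y := by
          rw [hV', volume_ball_three_mul_rpow hR _ (by linarith), hD, rescaling_constant hR hp0]
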